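/- There is an absolute constant $C$ such that the following holds. Let $(\Omega,\mathcal A,\mu)$ be a $\sigma$-finite measure space, and for $n\in\mathbb Z$ let $\mathcal Q_n\subset\mathcal A$ be a partition of $\Omega$ into sets of positive finite measure, such that every $Q\in\mathcal Q_n$ is a union of sets of $\mathcal Q_{n+1}$ and $\mathcal Q=\bigcup_{n\in\mathbb Z}\mathcal Q_n$ generates $\mathcal A$. The children of $P\in\mathcal Q$ are those $Q\in\mathcal Q$ for which $P$ is the minimal element of $\mathcal Q$ strictly containing $Q$; $\mathrm{ch}(P)$ is the set of them. Write $\langle f\rangle_Q=\mu(Q)^{-1}\int_Q f\,d\mu$ and $\Delta_P f=\sum_{Q\in\mathrm{ch}(P)}\mathbf 1_Q(\langle f\rangle_Q-\langle f\rangle_P)$. Let $\{b_Q : Q\in\mathcal Q\}$ be (real- or complex-valued) measurable functions with $\Delta_Q b_Q=b_Q$ almost everywhere for all $Q\in\mathcal Q$ and $$\sup_{P\in\mathcal Q}\ \mu(P)^{-1}\sum_{Q\in\mathcal Q,\ Q\subseteq P}\lVert b_Q\rVert_\infty^2\,\mu(Q)\le 1 .$$ Let $Q_0\in\mathcal Q$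 and let $f\in L^1(\Omega)$ (real- or complex-valued) be supported on $Q_0$. Then the martingale paraproduct $$\Pi f=\sum_{Q\in\mathcal Q}\langle f\rangle_Q\, b_Q$$ converges almost everywhere, as the limit for $m\to-\infty$ and $n\to\infty$ of the sums over $Q\in\bigcup_{k=m}^{n}\mathcal Q_k$, and there is a collection $\mathcal S\subseteq\mathcal Q$ which is sparse, that is, for each $P\in\mathcal S$ the maximal elements $Q$ of $\mathcal S$ that are strictly contained in $P$ satisfy $\sum_Q\mu(Q)\le\tfrac12\mu(P)$, such that $$\mathbf 1_{Q_0}\,\lvert\Pi f\rvert\ \le\ C\sum_{P\in\mathcal S}\langle\lvert f\rvert\rangle_P\,\mathbf 1_P\qquad\mu\text{-almost everywhere.}$$ -/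

import Mathlib

open MeasureTheory Filter Topology
open scoped NNReal ENNReal

noncomputable section

namespace MartingalePara

/-- Standing assumptions on the collections `𝒬 n`, `n ∈ ℤ`: each is a partition of `Ω` into
measurable sets of positive finite measure, `𝒬 (n + 1)` refines `𝒬 n`, and all the sets together
generate the σ-algebra. -/
structure IsMartingaleTree {Ω : Type*} [mΩ : MeasurableSpace Ω] (μ : Measure Ω)
    (𝒬 : ℤ → Set (Set Ω)) : Prop where
  measurableSet : ∀ n, ∀ Q ∈ 𝒬 n, MeasurableSet Q
  isPartition : ∀ n, Setoid.IsPartition (𝒬 n)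
  measure_pos : ∀ n, ∀ Q ∈ 𝒬 n, 0 < μ Q
  measure_lt_top : ∀ n, ∀ Q ∈ 𝒬 n, μ Q < ∞
  refines : ∀ n, ∀ Q ∈ 𝒬 n, ∃ 𝒞 ⊆ 𝒬 (n + 1), Q = ⋃₀ 𝒞
  generates : MeasurableSpace.generateFrom (⋃ n, 𝒬 n) = mΩ

/-- The tree `𝒬 = ⋃ n, 𝒬 n`. A set lying in several `𝒬 n` is a single element of the tree. -/
def tree {Ω : Type*} (𝒬 : ℤ → Set (Set Ω)) : Set (Set Ω) := ⋃ n, 𝒬 n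

/-- The children of `P`: those `Q` in the tree whose parent, the minimal element of the tree
strictly containing `Q`, is `P`. -/
def children {Ω : Type*} (𝒬 : ℤ → Set (Set Ω)) (P : Set Ω) : Set (Set Ω) :=
  {Q | Q ∈ tree 𝒬 ∧ Minimal (fun R => R ∈ tree 𝒬 ∧ Q ⊂ R) P}

/-- The martingale difference `Δ_P f = ∑_{Q ∈ ch(P)} 1_Q (⟨f⟩_Q - ⟨f⟩_P)`. The children of `P` are
disjoint, so that the sum has at most one nonzero term at each point. -/
def martingaleDiff {Ω : Type*} [MeasurableSpace Ω] {𝕜 : Type*} [RCLike 𝕜] (μ : Measure Ω)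
    (𝒬 : ℤ → Set (Set Ω)) (P : Set Ω) (f : Ω → 𝕜) (x : Ω) : 𝕜 :=
  ∑ᶠ Q ∈ children 𝒬 P,
    Q.indicator (fun _ => (⨍ y in Q, f y ∂μ) - ⨍ y in P, f y ∂μ) x

/-- The symbol of a martingale paraproduct: functions `b Q` with `Δ_Q (b Q) = b Q` (almost
everywhere) for each `Q` in the tree, normalized by
`sup_P μ(P)⁻¹ ∑_{Q ⊆ P} ‖b Q‖_∞ ^ 2 μ(Q) ≤ 1`. -/
structure IsParaproductSymbol {Ω : Type*} [MeasurableSpace Ω] {𝕜 : Type*} [RCLike 𝕜]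
    (μ : Measure Ω) (𝒬 : ℤ → Set (Set Ω)) (b : Set Ω → Ω → 𝕜) : Prop where
  aestronglyMeasurable : ∀ Q ∈ tree 𝒬, AEStronglyMeasurable (b Q) μ
  martingaleDiff_eq : ∀ Q ∈ tree 𝒬, martingaleDiff μ 𝒬 Q (b Q) =ᵐ[μ] b Q
  carleson : ⨆ P ∈ tree 𝒬,
    (μ P)⁻¹ * ∑' Q : {Q : Set Ω // Q ∈ tree 𝒬 ∧ Q ⊆ P}, eLpNorm (b Q) ∞ μ ^ 2 * μ (Q : Set Ω) ≤ 1

/-- The partial sum at `x` of `∑_Q ⟨f⟩_Q b_Q` over the tree elements `Q` that occur in the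
generations `m, …, n`, each counted once. As `b Q` vanishes (almost everywhere) outside `Q`, only
the finitely many `Q` that contain `x` enter. -/
def paraproductPartial {Ω : Type*} [MeasurableSpace Ω] {𝕜 : Type*} [RCLike 𝕜] (μ : Measure Ω)
    (𝒬 : ℤ → Set (Set Ω)) (b : Set Ω → Ω → 𝕜) (f : Ω → 𝕜) (m n : ℤ) (x : Ω) : 𝕜 :=
  ∑ᶠ Q ∈ {Q : Set Ω | x ∈ Q ∧ ∃ k ∈ Set.Icc m n, Q ∈ 𝒬 k}, (⨍ y in Q, f y ∂μ) * b Q x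

/-- The martingale paraproduct `Π f = ∑_Q ⟨f⟩_Q b_Q`: at each point the bilateral series along the
chain of the tree elements containing the point. -/
def paraproduct {Ω : Type*} [MeasurableSpace Ω] {𝕜 : Type*} [RCLike 𝕜] (μ : Measure Ω)
    (𝒬 : ℤ → Set (Set Ω)) (b : Set Ω → Ω → 𝕜) (f : Ω → 𝕜) (x : Ω) : 𝕜 :=
  limUnder (atBot ×ˢ atTop) (fun p : ℤ × ℤ => paraproductPartial μ 𝒬 b f p.1 p.2 x)

/-- The `𝒮`-children of `P`: the maximal elements of `𝒮` strictly contained in `P`. -/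
def sparseChildren {Ω : Type*} (𝒮 : Set (Set Ω)) (P : Set Ω) : Set (Set Ω) :=
  {Q | Maximal (fun R => R ∈ 𝒮 ∧ R ⊂ P) Q}

/-- A sparse subcollection of the tree. -/
def IsSparse {Ω : Type*} [MeasurableSpace Ω] (μ : Measure Ω) (𝒬 : ℤ → Set (Set Ω))
    (𝒮 : Set (Set Ω)) : Prop :=
  𝒮 ⊆ tree 𝒬 ∧ ∀ P ∈ 𝒮, ∑' Q : sparseChildren 𝒮 P, μ (Q : Set Ω) ≤ 2⁻¹ * μ P

/-- The sparse operator `S g = ∑_{P ∈ 𝒮} ⟨g⟩_P 1_P` on nonnegative functions. -/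
def sparseOp {Ω : Type*} [MeasurableSpace Ω] (μ : Measure Ω) (𝒮 : Set (Set Ω))
    (g : Ω → ℝ≥0∞) (x : Ω) : ℝ≥0∞ :=
  ∑' P : 𝒮, (P : Set Ω).indicator (fun _ => ⨍⁻ y in (P : Set Ω), g y ∂μ) x

end MartingalePara

end

/-! Along the decreasing cells containing a fixed point, the paraproduct is a sum of increments
`⟨f⟩_Q ⟨b_Q⟩_R`, where `R` is the next cell after `Q`: since `b_Q` equals its martingale difference,
it has mean zero on `Q` and is constant on each child. A cell that repeats in the next generation
contributes zero, so summing over generations counts each set once. A partial sum also carries one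
boundary term, which tends to zero because it either vanishes or equals a later increment
(`paraproductPartial_eq`, `tendsto_last_term`). The series is split at the generation `n₀` of `Q₀`.

Large sets: the single-term Carleson bound gives `|b_Q| ≤ 1`, and with mean zero `|⟨b_Q⟩_R| ≤ (μ Q -
μ R) / μ R`. The increment is therefore at most `‖f‖₁ (1 / μ R - 1 / μ Q)`, which telescopes; on
`Q₀` the total is at most `⟨|f|⟩_{Q₀}` (`exists_tendsto_sum_atBot`).

Small sets: the sums from `n₀` on form a martingale `V`. Given `P`, stop at the maximal `R ⊂ P` with
`⟨|f|⟩_R > 4⟨|f|⟩_P` or `|V R - V P| > 8⟨|f|⟩_P`. Before stopping `V - V P` is at most `8⟨|f|⟩_P`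
and the last jump is at most `4⟨|f|⟩_P`, so the stopped martingale is bounded by `12⟨|f|⟩_P`.
Orthogonality and the Carleson condition bound its squared `L²` norm by `(4⟨|f|⟩_P)² μ(P)`. By
Chebyshev the second condition stops on at most `μ(P) / 4`, and the maximal-function argument gives
`μ(P) / 4` for the first (`measure_sUnion_stopped_le`).

Iterating from `Q₀` yields a sparse family whose generations shrink geometrically, so almost every
point leaves it. Where no further stopping occurs, the bounded martingale converges; adding the
bounds `12⟨|f|⟩_P` along the stopping chain controls the limit by 12 times the sparse operator
(`ae_exists_tendsto_enorm_le_sparseOp`). With the large sets the constant is 13. -/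

noncomputable section

/-! ### Cells of the tree and their nesting -/

namespace MartingalePara

variable {Ω : Type*}

/-- The element of the partition `𝒬 n` that contains `x`. -/
def cell (𝒬 : ℤ → Set (Set Ω)) (n : ℤ) (x : Ω) : Set Ω := ⋃₀ {Q | Q ∈ 𝒬 n ∧ x ∈ Q}

namespace IsMartingaleTree

variable [MeasurableSpace Ω] {μ : Measure Ω} {𝒬 : ℤ → Set (Set Ω)} {Q R : Set Ω} {k m n : ℤ}
  {x y : Ω}

theorem cell_eq (ht : IsMartingaleTree μ 𝒬) (hQ : Q ∈ 𝒬 n) (hx : x ∈ Q) : cell 𝒬 n x = Q := by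
  obtain ⟨R, -, hR⟩ := (ht.isPartition n).2 x
  have : {Q | Q ∈ 𝒬 n ∧ x ∈ Q} = {Q} := by
    ext S
    simp only [Set.mem_ofPred_eq, Set.mem_singleton_iff]
    exact ⟨fun h => (hR S h).trans (hR Q ⟨hQ, hx⟩).symm, fun h => h ▸ ⟨hQ, hx⟩⟩
  rw [cell, this, Set.sUnion_singleton]

theorem cell_mem (ht : IsMartingaleTree μ 𝒬) (n : ℤ) (x : Ω) : cell 𝒬 n x ∈ 𝒬 n := by
  obtain ⟨R, hR, -⟩ := (ht.isPartition n).2 x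
  rw [ht.cell_eq hR.1 hR.2]
  exact hR.1

theorem mem_cell (ht : IsMartingaleTree μ 𝒬) (n : ℤ) (x : Ω) : x ∈ cell 𝒬 n x := by
  obtain ⟨R, hR, -⟩ := (ht.isPartition n).2 x
  rw [ht.cell_eq hR.1 hR.2]
  exact hR.2

theorem cell_mem_tree (ht : IsMartingaleTree μ 𝒬) (n : ℤ) (x : Ω) : cell 𝒬 n x ∈ tree 𝒬 :=
  Set.mem_iUnion.2 ⟨n, ht.cell_mem n x⟩

theorem cell_eq_cell (ht : IsMartingaleTree μ 𝒬) (h : y ∈ cell 𝒬 n x) :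
    cell 𝒬 n y = cell 𝒬 n x :=
  ht.cell_eq (ht.cell_mem n x) h

theorem cell_succ_subset (ht : IsMartingaleTree μ 𝒬) (n : ℤ) (x : Ω) :
    cell 𝒬 (n + 1) x ⊆ cell 𝒬 n x := by
  obtain ⟨𝒞, h𝒞, h⟩ := ht.refines n _ (ht.cell_mem n x)
  have hx := ht.mem_cell n x
  rw [h] at hx ⊢
  obtain ⟨S, hS, hxS⟩ := hx
  rw [ht.cell_eq (h𝒞 hS) hxS]
  exact Set.subset_sUnion_of_mem hS

theorem cell_anti (ht : IsMartingaleTree μ 𝒬) (h : m ≤ n) (x : Ω) :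
    cell 𝒬 n x ⊆ cell 𝒬 m x := by
  induction n, h using Int.leInduction with
  | base => exact subset_rfl
  | succ n _ ih => exact (ht.cell_succ_subset n x).trans ih

theorem cell_congr (ht : IsMartingaleTree μ 𝒬) (h : m ≤ n) (hxy : cell 𝒬 n x = cell 𝒬 n y) :
    cell 𝒬 m x = cell 𝒬 m y :=
  ht.cell_eq_cell (ht.cell_anti h y (hxy ▸ ht.mem_cell n x))

theorem cell_eq_of_le_of_le (ht : IsMartingaleTree μ 𝒬) (h₁ : m ≤ k) (h₂ : k ≤ n)
    (h : cell 𝒬 n x = cell 𝒬 m x) : cell 𝒬 k x = cell 𝒬 m x :=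
  (ht.cell_anti h₁ x).antisymm (h ▸ ht.cell_anti h₂ x)

theorem nonempty (ht : IsMartingaleTree μ 𝒬) (hQ : Q ∈ 𝒬 n) : Q.Nonempty :=
  nonempty_of_measure_ne_zero (ht.measure_pos n Q hQ).ne'

/-- Two elements of the tree with a common point, of generations `m ≤ n`, are nested. -/
theorem subset_of_mem (ht : IsMartingaleTree μ 𝒬) (hQ : Q ∈ 𝒬 n) (hR : R ∈ 𝒬 m) (h : m ≤ n)
    (hxQ : x ∈ Q) (hxR : x ∈ R) : Q ⊆ R := by
  rw [← ht.cell_eq hQ hxQ, ← ht.cell_eq hR hxR]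
  exact ht.cell_anti h x

theorem subset_or_subset (ht : IsMartingaleTree μ 𝒬) (hQ : Q ∈ tree 𝒬) (hR : R ∈ tree 𝒬)
    (hxQ : x ∈ Q) (hxR : x ∈ R) : Q ⊆ R ∨ R ⊆ Q := by
  obtain ⟨n, hn⟩ := Set.mem_iUnion.1 hQ
  obtain ⟨m, hm⟩ := Set.mem_iUnion.1 hR
  rcases le_total m n with h | h
  · exact Or.inl (ht.subset_of_mem hn hm h hxQ hxR)
  · exact Or.inr (ht.subset_of_mem hm hn h hxR hxQ)

theorem nonempty_of_mem_tree (ht : IsMartingaleTree μ 𝒬) (hQ : Q ∈ tree 𝒬) : Q.Nonempty := by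
  obtain ⟨n, hn⟩ := Set.mem_iUnion.1 hQ
  exact ht.nonempty hn

theorem measurableSet_of_mem_tree (ht : IsMartingaleTree μ 𝒬) (hQ : Q ∈ tree 𝒬) :
    MeasurableSet Q := by
  obtain ⟨n, hn⟩ := Set.mem_iUnion.1 hQ
  exact ht.measurableSet n Q hn

theorem measure_ne_zero (ht : IsMartingaleTree μ 𝒬) (hQ : Q ∈ tree 𝒬) : μ Q ≠ 0 := by
  obtain ⟨n, hn⟩ := Set.mem_iUnion.1 hQ
  exact (ht.measure_pos n Q hn).ne'

theorem measure_ne_top (ht : IsMartingaleTree μ 𝒬) (hQ : Q ∈ tree 𝒬) : μ Q ≠ ∞ := by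
  obtain ⟨n, hn⟩ := Set.mem_iUnion.1 hQ
  exact (ht.measure_lt_top n Q hn).ne

theorem disjoint (ht : IsMartingaleTree μ 𝒬) (hQ : Q ∈ 𝒬 n) (hR : R ∈ 𝒬 n) (h : Q ≠ R) :
    Disjoint Q R := by
  rw [Set.disjoint_left]
  intro x hxQ hxR
  exact h ((ht.cell_eq hQ hxQ).symm.trans (ht.cell_eq hR hxR))

/-- A set may belong to several generations, but these form an interval; this is what later lets
each set be counted exactly once, at its last generation. -/
theorem mem_of_le_of_le (ht : IsMartingaleTree μ 𝒬) (h₁ : m ≤ k) (h₂ : k ≤ n) (hm : Q ∈ 𝒬 m)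
    (hn : Q ∈ 𝒬 n) : Q ∈ 𝒬 k := by
  obtain ⟨x, hx⟩ := ht.nonempty hm
  have h := ht.cell_eq_of_le_of_le (x := x) h₁ h₂ ((ht.cell_eq hn hx).trans (ht.cell_eq hm hx).symm)
  rw [← ht.cell_eq hm hx, ← h]
  exact ht.cell_mem k x

/-- In a σ-finite space, a disjoint family of measurable sets of positive measure is countable. -/
theorem countable [SigmaFinite μ] (ht : IsMartingaleTree μ 𝒬) (n : ℤ) : (𝒬 n).Countable := by
  have h := Measure.countable_meas_pos_of_disjoint_iUnion (μ := μ) (As := fun Q : 𝒬 n => (Q : Set Ω))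
    (fun Q => ht.measurableSet n Q Q.2)
    (fun Q R h => ht.disjoint Q.2 R.2 (fun h' => h (Subtype.ext h')))
  have h' : {Q : 𝒬 n | 0 < μ (Q : Set Ω)} = Set.univ :=
    Set.eq_univ_of_forall fun Q => ht.measure_pos n Q Q.2
  rw [h', Set.countable_univ_iff] at h
  exact Set.countable_coe_iff.1 h

theorem countable_tree [SigmaFinite μ] (ht : IsMartingaleTree μ 𝒬) : (tree 𝒬).Countable :=
  Set.countable_iUnion ht.countable

/-- The elements of `𝒬 n` inside a set `s` that is a union of such elements. -/
theorem sUnion_eq (ht : IsMartingaleTree μ 𝒬) {s : Set Ω} (hs : ∀ x ∈ s, cell 𝒬 n x ⊆ s) :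
    ⋃₀ {R | R ∈ 𝒬 n ∧ R ⊆ s} = s := by
  ext x
  constructor
  · rintro ⟨R, hR, hx⟩
    exact hR.2 hx
  · intro hx
    exact ⟨cell 𝒬 n x, ⟨ht.cell_mem n x, hs x hx⟩, ht.mem_cell n x⟩

theorem cell_subset_of_mem (ht : IsMartingaleTree μ 𝒬) (hQ : Q ∈ 𝒬 m) (h : m ≤ n) (hx : x ∈ Q) :
    cell 𝒬 n x ⊆ Q :=
  (ht.cell_anti h x).trans (ht.cell_eq hQ hx).subset

theorem measurableSet_of_cell [SigmaFinite μ] (ht : IsMartingaleTree μ 𝒬) {s : Set Ω}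
    (hs : ∀ x ∈ s, cell 𝒬 n x ⊆ s) : MeasurableSet s := by
  rw [← ht.sUnion_eq hs]
  exact MeasurableSet.sUnion ((ht.countable n).mono fun _ h => h.1)
    fun R hR => ht.measurableSet n R hR.1

/-- The σ-algebra generated by the partition `𝒬 n`: all unions of its elements. -/
@[reducible]
def sigmaAlgebra (ht : IsMartingaleTree μ 𝒬) (n : ℤ) : MeasurableSpace Ω where
  MeasurableSet' s := ∀ x ∈ s, cell 𝒬 n x ⊆ s
  measurableSet_empty := fun x hx => hx.elim
  measurableSet_compl := fun s hs x hx y hy hys =>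
    hx (hs y hys (ht.cell_eq_cell hy ▸ ht.mem_cell n x))
  measurableSet_iUnion := fun s hs x hx => by
    obtain ⟨i, hi⟩ := Set.mem_iUnion.1 hx
    exact (hs i x hi).trans (Set.subset_iUnion s i)

/-- The filtration of the partitions from the generation `p` on. -/
def filtration [SigmaFinite μ] (ht : IsMartingaleTree μ 𝒬) (p : ℤ) :
    Filtration ℕ ‹MeasurableSpace Ω› where
  seq i := ht.sigmaAlgebra (p + i)
  mono' i j hij s hs x hx := (ht.cell_anti (by omega) x).trans (hs x hx)
  le' _ _ hs := ht.measurableSet_of_cell hs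

theorem measurable_sigmaAlgebra (ht : IsMartingaleTree μ 𝒬) {β : Type*} [MeasurableSpace β]
    {g : Ω → β} (hg : ∀ x y, cell 𝒬 n x = cell 𝒬 n y → g x = g y) :
    Measurable[ht.sigmaAlgebra n] g := by
  intro s _ x hx y hy
  have := hg y x (ht.cell_eq_cell hy)
  simpa [this] using hx

theorem measurable_of_cell [SigmaFinite μ] (ht : IsMartingaleTree μ 𝒬) {β : Type*}
    [MeasurableSpace β] {g : Ω → β} (hg : ∀ x y, cell 𝒬 n x = cell 𝒬 n y → g x = g y) :
    Measurable g := fun _ hs =>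
  ht.measurableSet_of_cell (ht.measurable_sigmaAlgebra hg hs)

/-- A set integral over a union of elements of `𝒬 n` as a sum. -/
theorem lintegral_eq_tsum [SigmaFinite μ] (ht : IsMartingaleTree μ 𝒬) {s : Set Ω}
    (hs : ∀ x ∈ s, cell 𝒬 n x ⊆ s) (g : Ω → ℝ≥0∞) :
    ∫⁻ x in s, g x ∂μ = ∑' R : {R | R ∈ 𝒬 n ∧ R ⊆ s}, ∫⁻ x in (R : Set Ω), g x ∂μ := by
  have hc : {R | R ∈ 𝒬 n ∧ R ⊆ s}.Countable := (ht.countable n).mono fun _ h => h.1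
  conv_lhs => rw [← ht.sUnion_eq hs, Set.sUnion_eq_biUnion]
  exact lintegral_biUnion hc (fun R hR => ht.measurableSet n R hR.1)
    (fun R hR S hS h => ht.disjoint hR.1 hS.1 h) g

theorem setIntegral_eq_zero [SigmaFinite μ] (ht : IsMartingaleTree μ 𝒬) {E : Type*}
    [NormedAddCommGroup E] [NormedSpace ℝ E] {s : Set Ω}
    (hs : ∀ x ∈ s, cell 𝒬 n x ⊆ s) {g : Ω → E} (hg : IntegrableOn g s μ)
    (h0 : ∀ R ∈ 𝒬 n, R ⊆ s → ∫ x in R, g x ∂μ = 0) : ∫ x in s, g x ∂μ = 0 := by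
  have hc : {R | R ∈ 𝒬 n ∧ R ⊆ s}.Countable := (ht.countable n).mono fun _ h => h.1
  have := hc.to_subtype
  have h := integral_iUnion (μ := μ) (f := g)
    (s := fun R : {R | R ∈ 𝒬 n ∧ R ⊆ s} => (R : Set Ω))
    (fun R => ht.measurableSet n R R.2.1)
    (fun R S h => ht.disjoint R.2.1 S.2.1 (fun h' => h (Subtype.ext h')))
    (by rwa [← Set.sUnion_eq_iUnion, ht.sUnion_eq hs])
  rw [← Set.sUnion_eq_iUnion, ht.sUnion_eq hs] at h
  rw [h]
  exact (tsum_congr fun R : {R | R ∈ 𝒬 n ∧ R ⊆ s} => h0 R R.2.1 R.2.2).trans tsum_zero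

end IsMartingaleTree

end MartingalePara

/-! ### The paraproduct as a sum of increments along cells -/

namespace MartingalePara

theorem sum_Ico_add_one {M : Type*} [AddCommMonoid M] (g : ℤ → M) {m n : ℤ} (h : m ≤ n) :
    ∑ k ∈ Finset.Ico m (n + 1), g k = ∑ k ∈ Finset.Ico m n, g k + g n := by
  have : Finset.Ico m (n + 1) = insert n (Finset.Ico m n) := by
    ext k
    simp only [Finset.mem_Ico, Finset.mem_insert]
    omega
  rw [this, Finset.sum_insert (by simp), add_comm]

variable {Ω : Type*} [MeasurableSpace Ω] {μ : Measure Ω} {𝒬 : ℤ → Set (Set Ω)} {P Q R : Set Ω}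
  {k m n : ℤ} {x y : Ω} {𝕜 : Type*} [RCLike 𝕜] {b : Set Ω → Ω → 𝕜} {f : Ω → 𝕜}

theorem enorm_setAverage_le (g : Ω → 𝕜) (s : Set Ω) :
    ‖⨍ y in s, g y ∂μ‖ₑ ≤ ⨍⁻ y in s, ‖g y‖ₑ ∂μ :=
  enorm_integral_le_lintegral_enorm g

theorem IsMartingaleTree.setAverage_eq_of_ae (ht : IsMartingaleTree μ 𝒬) (hQ : Q ∈ tree 𝒬)
    {g : Ω → 𝕜} {c : 𝕜} (h : ∀ᵐ x ∂μ, x ∈ Q → g x = c) : ⨍ y in Q, g y ∂μ = c := by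
  rw [setAverage_congr_fun (g := fun _ => c) (ht.measurableSet_of_mem_tree hQ) h]
  exact setAverage_const (ht.measure_ne_zero hQ) (ht.measure_ne_top hQ) c

theorem IsMartingaleTree.cell_mem_children (ht : IsMartingaleTree μ 𝒬)
    (h : cell 𝒬 (n + 1) x ≠ cell 𝒬 n x) : cell 𝒬 (n + 1) x ∈ children 𝒬 (cell 𝒬 n x) := by
  refine ⟨ht.cell_mem_tree _ x, ⟨ht.cell_mem_tree _ x,
    (ht.cell_succ_subset n x).ssubset_of_ne h⟩, ?_⟩
  rintro R ⟨hR, hxR⟩ -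
  obtain ⟨j, hj⟩ := Set.mem_iUnion.1 hR
  have hx : x ∈ R := hxR.subset (ht.mem_cell _ x)
  rcases le_or_gt j n with h' | h'
  · rw [← ht.cell_eq hj hx]
    exact ht.cell_anti h' x
  · have := ht.cell_anti (x := x) (show n + 1 ≤ j by omega)
    rw [ht.cell_eq hj hx] at this
    exact absurd hxR this.not_ssubset

theorem martingaleDiff_eq_of_mem (ht : IsMartingaleTree μ 𝒬) (g : Ω → 𝕜)
    (hQ : Q ∈ children 𝒬 P) (hx : x ∈ Q) :
    martingaleDiff μ 𝒬 P g x = (⨍ y in Q, g y ∂μ) - ⨍ y in P, g y ∂μ := by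
  have hu : ∀ R ∈ children 𝒬 P, x ∈ R → R = Q := by
    intro R hR hxR
    rcases ht.subset_or_subset hR.1 hQ.1 hxR hx with h | h
    · by_contra hne
      exact (hR.2.2 ⟨hQ.1, h.ssubset_of_ne hne⟩ hQ.2.1.2.subset).not_ssubset hQ.2.1.2
    · by_contra hne
      exact (hQ.2.2 ⟨hR.1, h.ssubset_of_ne (Ne.symm hne)⟩ hR.2.1.2.subset).not_ssubset hR.2.1.2
  classical
  rw [martingaleDiff, finsum_eq_single _ Q, finsum_eq_if, if_pos hQ, Set.indicator_of_mem hx]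
  intro R hne
  rw [finsum_eq_if]
  split_ifs with hR
  · exact Set.indicator_of_notMem (fun hxR => hne (hu R hR hxR)) _
  · rfl

theorem martingaleDiff_eq_zero (g : Ω → 𝕜) (h : ∀ Q ∈ children 𝒬 P, x ∉ Q) :
    martingaleDiff μ 𝒬 P g x = 0 := by
  rw [martingaleDiff]
  refine finsum_mem_eq_zero_of_forall_eq_zero fun Q hQ => Set.indicator_of_notMem (h Q hQ) _

theorem IsMartingaleTree.notMem_children (ht : IsMartingaleTree μ 𝒬) (hP : ∀ j ≥ n, P ∈ 𝒬 j) :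
    Q ∉ children 𝒬 P := by
  intro hQ
  obtain ⟨j, hj⟩ := Set.mem_iUnion.1 hQ.1
  obtain ⟨x, hx⟩ := ht.nonempty hj
  have hss := hQ.2.1.2
  have hxP := hss.subset hx
  rcases le_total n j with h | h
  · exact hss.ne ((ht.cell_eq hj hx).symm.trans (ht.cell_eq (hP j h) hxP))
  · exact (ht.subset_of_mem (hP n le_rfl) hj h hxP hx).not_ssubset hss

namespace IsParaproductSymbol

/-- The points where every `b Q` agrees with its martingale difference. -/
def IsRegular (μ : Measure Ω) (𝒬 : ℤ → Set (Set Ω)) (b : Set Ω → Ω → 𝕜) (x : Ω) : Prop :=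
  ∀ Q ∈ tree 𝒬, martingaleDiff μ 𝒬 Q (b Q) x = b Q x

theorem ae_isRegular [SigmaFinite μ] (ht : IsMartingaleTree μ 𝒬)
    (hb : IsParaproductSymbol μ 𝒬 b) : ∀ᵐ x ∂μ, IsRegular μ 𝒬 b x :=
  (ae_ball_iff ht.countable_tree).2 hb.martingaleDiff_eq

theorem tsum_le (ht : IsMartingaleTree μ 𝒬) (hb : IsParaproductSymbol μ 𝒬 b) (hP : P ∈ tree 𝒬) :
    ∑' Q : {Q : Set Ω // Q ∈ tree 𝒬 ∧ Q ⊆ P}, eLpNorm (b Q) ∞ μ ^ 2 * μ (Q : Set Ω) ≤ μ P := by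
  have h := (le_iSup₂ (f := fun P (_ : P ∈ tree 𝒬) => (μ P)⁻¹ *
    ∑' Q : {Q : Set Ω // Q ∈ tree 𝒬 ∧ Q ⊆ P}, eLpNorm (b Q) ∞ μ ^ 2 * μ (Q : Set Ω)) P hP).trans
    hb.carleson
  rwa [mul_comm, ← div_eq_mul_inv, ENNReal.div_le_iff (ht.measure_ne_zero hP) (ht.measure_ne_top hP),
    one_mul] at h

/-- Keep only the term `Q` itself in the Carleson sum over subsets of `Q`. -/
theorem eLpNorm_le_one (ht : IsMartingaleTree μ 𝒬) (hb : IsParaproductSymbol μ 𝒬 b)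
    (hQ : Q ∈ tree 𝒬) : eLpNorm (b Q) ∞ μ ≤ 1 := by
  have h := (ENNReal.le_tsum (f := fun R : {R : Set Ω // R ∈ tree 𝒬 ∧ R ⊆ Q} =>
    eLpNorm (b R) ∞ μ ^ 2 * μ (R : Set Ω)) ⟨Q, hQ, subset_rfl⟩).trans (hb.tsum_le ht hQ)
  have h2 : eLpNorm (b Q) ∞ μ ^ 2 ≤ 1 :=
    (ENNReal.mul_le_mul_iff_left (ht.measure_ne_zero hQ) (ht.measure_ne_top hQ)).1
      (by simpa using h)
  by_contra hlt
  exact absurd h2 (not_le.2 (one_lt_pow₀ (not_le.1 hlt) two_ne_zero))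

theorem ae_enorm_le (b : Set Ω → Ω → 𝕜) (Q : Set Ω) :
    ∀ᵐ x ∂μ, ‖b Q x‖ₑ ≤ eLpNorm (b Q) ∞ μ := by
  rw [eLpNorm_exponent_top]
  exact ae_le_eLpNormEssSup

theorem ae_norm_le_one (ht : IsMartingaleTree μ 𝒬) (hb : IsParaproductSymbol μ 𝒬 b)
    (hQ : Q ∈ tree 𝒬) : ∀ᵐ x ∂μ, ‖b Q x‖ ≤ 1 := by
  filter_upwards [ae_enorm_le (μ := μ) b Q] with x hx
  have := hx.trans (hb.eLpNorm_le_one ht hQ)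
  rwa [← ofReal_norm, ENNReal.ofReal_le_one] at this

theorem integrableOn (ht : IsMartingaleTree μ 𝒬) (hb : IsParaproductSymbol μ 𝒬 b)
    (hQ : Q ∈ tree 𝒬) {s : Set Ω} (hs : μ s ≠ ∞) : IntegrableOn (b Q) s μ :=
  Measure.integrableOn_of_bounded hs (hb.aestronglyMeasurable Q hQ)
    (ae_restrict_of_ae (hb.ae_norm_le_one ht hQ))

theorem enorm_setAverage_le_eLpNorm (b : Set Ω → Ω → 𝕜) (Q R : Set Ω) :
    ‖⨍ y in R, b Q y ∂μ‖ₑ ≤ eLpNorm (b Q) ∞ μ := by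
  refine (enorm_setAverage_le _ _).trans ?_
  rw [setLAverage_eq]
  refine ENNReal.div_le_of_le_mul ?_
  rw [← setLIntegral_const]
  exact lintegral_mono_ae (ae_restrict_of_ae (ae_enorm_le b Q))

/-- On one child `R` the identity `b_Q = ⟨b_Q⟩_R - ⟨b_Q⟩_Q` holds almost everywhere; averaging over
`R` already forces `⟨b_Q⟩_Q = 0`. Without children, the martingale difference is the zero function.
-/
theorem setAverage_eq_zero [SigmaFinite μ] (ht : IsMartingaleTree μ 𝒬)
    (hb : IsParaproductSymbol μ 𝒬 b) (hQ : Q ∈ tree 𝒬) : ⨍ y in Q, b Q y ∂μ = 0 := by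
  by_cases hc : ∃ R, R ∈ children 𝒬 Q
  · obtain ⟨R, hR⟩ := hc
    have h : ⨍ y in R, b Q y ∂μ = (⨍ y in R, b Q y ∂μ) - ⨍ y in Q, b Q y ∂μ := by
      refine ht.setAverage_eq_of_ae hR.1 ?_
      filter_upwards [hb.ae_isRegular ht] with x hx hxR
      rw [← hx Q hQ, martingaleDiff_eq_of_mem ht _ hR hxR]
    exact (sub_eq_self.1 h.symm)
  · refine ht.setAverage_eq_of_ae hQ ?_
    filter_upwards [hb.ae_isRegular ht] with x hx _
    rw [← hx Q hQ]
    exact martingaleDiff_eq_zero _ fun R hR => (hc ⟨R, hR⟩).elim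

theorem setIntegral_eq_zero [SigmaFinite μ] (ht : IsMartingaleTree μ 𝒬)
    (hb : IsParaproductSymbol μ 𝒬 b) (hQ : Q ∈ tree 𝒬) : ∫ y in Q, b Q y ∂μ = 0 := by
  rw [← measure_smul_setAverage _ (ht.measure_ne_top hQ), hb.setAverage_eq_zero ht hQ, smul_zero]

theorem apply_cell [SigmaFinite μ] (ht : IsMartingaleTree μ 𝒬) (hb : IsParaproductSymbol μ 𝒬 b)
    (hx : IsRegular μ 𝒬 b x) (h : cell 𝒬 (n + 1) x ≠ cell 𝒬 n x) :
    b (cell 𝒬 n x) x = ⨍ y in cell 𝒬 (n + 1) x, b (cell 𝒬 n x) y ∂μ := by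
  have hQ := ht.cell_mem_tree n x
  rw [← hx _ hQ, martingaleDiff_eq_of_mem ht _ (ht.cell_mem_children h) (ht.mem_cell _ x),
    hb.setAverage_eq_zero ht hQ, sub_zero]

theorem apply_cell_eq_zero (ht : IsMartingaleTree μ 𝒬)
    (hx : IsRegular μ 𝒬 b x) (h : ∀ j ≥ n, cell 𝒬 j x = cell 𝒬 n x) : b (cell 𝒬 n x) x = 0 := by
  rw [← hx _ (ht.cell_mem_tree n x)]
  exact martingaleDiff_eq_zero _ fun Q hQ =>
    (ht.notMem_children (fun j hj => h j hj ▸ ht.cell_mem j x) hQ).elim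

end IsParaproductSymbol

/-- The contribution of the generation `n` to the martingale paraproduct. It vanishes at the points
whose element of `𝒬 n` also belongs to `𝒬 (n + 1)`. -/
def increment (μ : Measure Ω) (𝒬 : ℤ → Set (Set Ω)) (b : Set Ω → Ω → 𝕜) (f : Ω → 𝕜) (n : ℤ)
    (x : Ω) : 𝕜 :=
  (⨍ y in cell 𝒬 n x, f y ∂μ) * ⨍ y in cell 𝒬 (n + 1) x, b (cell 𝒬 n x) y ∂μ

theorem increment_congr (ht : IsMartingaleTree μ 𝒬) (b : Set Ω → Ω → 𝕜) (f : Ω → 𝕜)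
    (h : cell 𝒬 (n + 1) x = cell 𝒬 (n + 1) y) :
    increment μ 𝒬 b f n x = increment μ 𝒬 b f n y := by
  rw [increment, increment, h, ht.cell_congr (by omega) h]

theorem increment_eq_zero [SigmaFinite μ] (ht : IsMartingaleTree μ 𝒬)
    (hb : IsParaproductSymbol μ 𝒬 b) (f : Ω → 𝕜) (h : cell 𝒬 (n + 1) x = cell 𝒬 n x) :
    increment μ 𝒬 b f n x = 0 := by
  rw [increment, h, hb.setAverage_eq_zero ht (ht.cell_mem_tree n x), mul_zero]

theorem increment_eq [SigmaFinite μ] (ht : IsMartingaleTree μ 𝒬)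
    (hb : IsParaproductSymbol μ 𝒬 b) (f : Ω → 𝕜) (hx : IsParaproductSymbol.IsRegular μ 𝒬 b x)
    (h : cell 𝒬 (n + 1) x ≠ cell 𝒬 n x) :
    increment μ 𝒬 b f n x = (⨍ y in cell 𝒬 n x, f y ∂μ) * b (cell 𝒬 n x) x := by
  rw [increment, hb.apply_cell ht hx h]

theorem setOf_mem_Icc_eq (ht : IsMartingaleTree μ 𝒬) (m n : ℤ) (x : Ω) :
    {Q : Set Ω | x ∈ Q ∧ ∃ k ∈ Set.Icc m n, Q ∈ 𝒬 k} = (fun k => cell 𝒬 k x) '' Set.Icc m n := by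
  ext Q
  constructor
  · rintro ⟨hx, k, hk, hQ⟩
    exact ⟨k, hk, ht.cell_eq hQ hx⟩
  · rintro ⟨k, hk, rfl⟩
    exact ⟨ht.mem_cell k x, k, hk, ht.cell_mem k x⟩

/-- The last cell needs a separate term: whether and where it splits is decided by generations after
`n`, so its value `b_Q x` is not yet an increment of the range. -/
theorem paraproductPartial_eq [SigmaFinite μ] (ht : IsMartingaleTree μ 𝒬)
    (hb : IsParaproductSymbol μ 𝒬 b) (f : Ω → 𝕜) (hx : IsParaproductSymbol.IsRegular μ 𝒬 b x)
    (h : m ≤ n) :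
    paraproductPartial μ 𝒬 b f m n x = ∑ k ∈ Finset.Ico m n, increment μ 𝒬 b f k x +
      (⨍ y in cell 𝒬 n x, f y ∂μ) * b (cell 𝒬 n x) x := by
  induction n, h using Int.leInduction with
  | base =>
    rw [paraproductPartial, setOf_mem_Icc_eq ht]
    simp
  | succ n hmn ih =>
    rw [paraproductPartial, setOf_mem_Icc_eq ht] at ih ⊢
    have hI : Set.Icc m (n + 1) = insert (n + 1) (Set.Icc m n) := by
      ext k
      simp only [Set.mem_Icc, Set.mem_insert_iff]
      omega
    rw [hI, Set.image_insert_eq, sum_Ico_add_one _ hmn]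
    -- If the cell repeats, no new set enters the partial sum and the increment vanishes; otherwise
    -- the old boundary term becomes the new increment.
    by_cases hc : cell 𝒬 (n + 1) x = cell 𝒬 n x
    · have hmem : cell 𝒬 n x ∈ (fun k => cell 𝒬 k x) '' Set.Icc m n :=
        Set.mem_image_of_mem (fun k => cell 𝒬 k x) (Set.mem_Icc.2 ⟨hmn, le_rfl⟩)
      rw [increment_eq_zero ht hb f hc, hc, Set.insert_eq_of_mem hmem, ih, add_zero]
    · rw [finsum_mem_insert _ _ ((Set.finite_Icc m n).image _), ih, increment_eq ht hb f hx hc]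
      · ring
      · rintro ⟨k, hk, hkn⟩
        have hkn' : cell 𝒬 (n + 1) x = cell 𝒬 k x := hkn.symm
        exact hc (hkn'.trans
          (ht.cell_eq_of_le_of_le hk.2 (by omega : n ≤ n + 1) hkn').symm)

/-- A cell that never splits has no children, so its term is zero; otherwise its term equals the
increment at the later generation `i` where it splits. -/
theorem tendsto_last_term [SigmaFinite μ] (ht : IsMartingaleTree μ 𝒬)
    (hb : IsParaproductSymbol μ 𝒬 b) (hx : IsParaproductSymbol.IsRegular μ 𝒬 b x)
    (h : Tendsto (fun n => increment μ 𝒬 b f n x) atTop (𝓝 0)) :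
    Tendsto (fun n => (⨍ y in cell 𝒬 n x, f y ∂μ) * b (cell 𝒬 n x) x) atTop (𝓝 0) := by
  rw [Metric.tendsto_atTop] at h ⊢
  intro ε hε
  obtain ⟨N, hN⟩ := h ε hε
  refine ⟨N, fun n hn => ?_⟩
  by_cases hc : ∀ j ≥ n, cell 𝒬 j x = cell 𝒬 n x
  · rw [IsParaproductSymbol.apply_cell_eq_zero ht hx hc, mul_zero, dist_self]
    exact hε
  · push Not at hc
    obtain ⟨j, hj, hne⟩ := hc
    have key : ∀ j ≥ n, cell 𝒬 j x ≠ cell 𝒬 n x →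
        ∃ i ≥ n, cell 𝒬 i x = cell 𝒬 n x ∧ cell 𝒬 (i + 1) x ≠ cell 𝒬 n x := by
      intro j hj
      induction j, hj using Int.leInduction with
      | base => exact fun h => (h rfl).elim
      | succ j hj ih =>
        intro hne
        by_cases hj' : cell 𝒬 j x = cell 𝒬 n x
        · exact ⟨j, hj, hj', hne⟩
        · exact ih hj'
    obtain ⟨i, hi, h1, h2⟩ := key j hj hne
    have := hN i (hn.le.trans hi)
    rwa [increment_eq ht hb f hx (h1 ▸ h2), h1] at this

end MartingalePara

/-! ### Convergence over the large sets -/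

namespace MartingalePara

variable {Ω : Type*} [MeasurableSpace Ω] {μ : Measure Ω} {𝒬 : ℤ → Set (Set Ω)} {P Q R : Set Ω}
  {k m n : ℤ} {x y : Ω} {𝕜 : Type*} [RCLike 𝕜] {b : Set Ω → Ω → 𝕜} {f : Ω → 𝕜}

theorem IsMartingaleTree.measureReal_pos (ht : IsMartingaleTree μ 𝒬) (hQ : Q ∈ tree 𝒬) :
    0 < μ.real Q :=
  ENNReal.toReal_pos (ht.measure_ne_zero hQ) (ht.measure_ne_top hQ)

/-- By mean zero the integral over `R` is minus that over `Q \ R`, where the integrand is at most 1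
in norm. -/
theorem norm_setAverage_symbol_le [SigmaFinite μ] (ht : IsMartingaleTree μ 𝒬)
    (hb : IsParaproductSymbol μ 𝒬 b) (hQ : Q ∈ tree 𝒬) (hR : R ∈ tree 𝒬) (h : R ⊆ Q) :
    ‖⨍ y in R, b Q y ∂μ‖ ≤ (μ.real Q - μ.real R) / μ.real R := by
  have hR0 := ht.measureReal_pos hR
  have hQm := ht.measure_ne_top hQ
  have hRm := ht.measurableSet_of_mem_tree hR
  have hdm : μ (Q \ R) ≠ ∞ := measure_ne_top_of_subset Set.sdiff_subset hQm
  have h1 : ∫ y in R, b Q y ∂μ = -∫ y in Q \ R, b Q y ∂μ := by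
    rw [setIntegral_sdiff hRm (hb.integrableOn ht hQ hQm) h, hb.setIntegral_eq_zero ht hQ]
    simp
  have h2 : ‖∫ y in Q \ R, b Q y ∂μ‖ ≤ 1 * μ.real (Q \ R) :=
    norm_setIntegral_le_of_norm_le_const_ae hdm.lt_top
      (ae_restrict_of_ae (hb.ae_norm_le_one ht hQ))
  rw [measureReal_sdiff h hRm hQm, one_mul] at h2
  rw [setAverage_eq, norm_smul, norm_inv, Real.norm_of_nonneg hR0.le, h1, norm_neg, inv_mul_eq_div]
  gcongr

theorem norm_setAverage_le_div (hf : Integrable f μ) (Q : Set Ω) :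
    ‖⨍ y in Q, f y ∂μ‖ ≤ (∫ y, ‖f y‖ ∂μ) / μ.real Q := by
  rw [setAverage_eq, norm_smul, norm_inv, Real.norm_of_nonneg measureReal_nonneg, inv_mul_eq_div]
  gcongr
  exact (norm_integral_le_integral_norm _).trans
    (setIntegral_le_integral hf.norm (ae_of_all _ fun _ => norm_nonneg _))

/-- The factor `μ Q` from the average of `f` turns the bound on the symbol into a difference of
reciprocals, which telescopes in `n`. -/
theorem norm_increment_le_sub [SigmaFinite μ] (ht : IsMartingaleTree μ 𝒬)
    (hb : IsParaproductSymbol μ 𝒬 b) (hf : Integrable f μ) (n : ℤ) (x : Ω) :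
    ‖increment μ 𝒬 b f n x‖ ≤ (∫ y, ‖f y‖ ∂μ) *
      ((μ.real (cell 𝒬 (n + 1) x))⁻¹ - (μ.real (cell 𝒬 n x))⁻¹) := by
  have hQ := ht.cell_mem_tree n x
  have hR := ht.cell_mem_tree (n + 1) x
  have hQ0 := ht.measureReal_pos hQ
  have hR0 := ht.measureReal_pos hR
  rw [increment, norm_mul]
  calc _ ≤ (∫ y, ‖f y‖ ∂μ) / μ.real (cell 𝒬 n x) *
        ((μ.real (cell 𝒬 n x) - μ.real (cell 𝒬 (n + 1) x)) / μ.real (cell 𝒬 (n + 1) x)) :=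
        mul_le_mul (norm_setAverage_le_div hf _)
          (norm_setAverage_symbol_le ht hb hQ hR (ht.cell_succ_subset n x)) (norm_nonneg _)
          (div_nonneg (integral_nonneg fun _ => norm_nonneg _) hQ0.le)
    _ = _ := by field_simp

theorem sum_Ico_sub_eq_sum_range (g : ℤ → 𝕜) (N : ℤ) (j : ℕ) :
    ∑ k ∈ Finset.Ico (N - j) N, g k = ∑ i ∈ Finset.range j, g (N - (i + 1)) := by
  induction j with
  | zero => simp
  | succ j ih =>
    have : Finset.Ico (N - (j + 1 : ℕ)) N = insert (N - (j + 1 : ℤ)) (Finset.Ico (N - j) N) := by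
      ext k
      simp only [Finset.mem_Ico, Finset.mem_insert]
      omega
    rw [this, Finset.sum_insert (by simp; omega), Finset.sum_range_succ, ih, add_comm]

/-- The contributions of the large elements of the tree. -/
theorem exists_tendsto_sum_atBot [SigmaFinite μ] (ht : IsMartingaleTree μ 𝒬)
    (hb : IsParaproductSymbol μ 𝒬 b) (hf : Integrable f μ) (N : ℤ) (x : Ω) :
    ∃ L : 𝕜, Tendsto (fun m => ∑ k ∈ Finset.Ico m N, increment μ 𝒬 b f k x) atBot (𝓝 L) ∧
      ‖L‖ₑ ≤ (∫⁻ y, ‖f y‖ₑ ∂μ) / μ (cell 𝒬 N x) := by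
  set I := ∫ y, ‖f y‖ ∂μ with hI
  have hI0 : 0 ≤ I := integral_nonneg fun _ => norm_nonneg _
  have hle : ∀ j : ℕ, ∑ i ∈ Finset.range j, ‖increment μ 𝒬 b f (N - (i + 1)) x‖ ≤
      I * ((μ.real (cell 𝒬 N x))⁻¹ - (μ.real (cell 𝒬 (N - j) x))⁻¹) := by
    intro j
    induction j with
    | zero => simp
    | succ j ih =>
      rw [Finset.sum_range_succ]
      have h := norm_increment_le_sub ht hb hf (N - (j + 1)) x
      rw [show N - ((j : ℤ) + 1) + 1 = N - j by ring] at h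
      push_cast
      linarith
  have hle' : ∀ j : ℕ, ∑ i ∈ Finset.range j, ‖increment μ 𝒬 b f (N - (i + 1)) x‖ ≤
      I * (μ.real (cell 𝒬 N x))⁻¹ := fun j =>
    (hle j).trans (mul_le_mul_of_nonneg_left (sub_le_self _ (inv_nonneg.2 measureReal_nonneg)) hI0)
  have hs := summable_of_sum_range_le (fun _ => norm_nonneg _) hle'
  refine ⟨∑' i : ℕ, increment μ 𝒬 b f (N - (i + 1)) x, ?_, ?_⟩
  · have h1 := hs.of_norm.hasSum.tendsto_sum_nat
    have h2 : Tendsto (fun m : ℤ => (N - m).toNat) atBot atTop := by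
      refine tendsto_atTop.2 fun j => ?_
      filter_upwards [eventually_le_atBot (N - j)] with m hm
      omega
    refine (h1.comp h2).congr' ?_
    filter_upwards [eventually_le_atBot N] with m hm
    have := sum_Ico_sub_eq_sum_range (fun k => increment μ 𝒬 b f k x) N (N - m).toNat
    rw [show N - ((N - m).toNat : ℤ) = m by omega] at this
    exact this.symm
  · have h3 : ‖∑' i : ℕ, increment μ 𝒬 b f (N - (i + 1)) x‖ ≤ I * (μ.real (cell 𝒬 N x))⁻¹ :=
      (norm_tsum_le_tsum_norm hs).trans (Real.tsum_le_of_sum_range_le (fun _ => norm_nonneg _) hle')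
    have hQ := ht.cell_mem_tree N x
    rw [← ofReal_norm]
    refine (ENNReal.ofReal_le_ofReal h3).trans_eq ?_
    rw [← div_eq_mul_inv, ENNReal.ofReal_div_of_pos (ht.measureReal_pos hQ),
      ofReal_measureReal (ht.measure_ne_top hQ), hI, ofReal_integral_norm_eq_lintegral_enorm hf]

end MartingalePara

/-! ### The stopping time and the stopped martingale -/

namespace MartingalePara

/-- Pythagoras for the real inner product: the cross term is the inner product of `c` with the mean
of `δ`. -/
theorem lintegral_enorm_sq_const_add {α : Type*} [MeasurableSpace α] {ν : Measure α}
    [IsFiniteMeasure ν] {E : Type*} [NormedAddCommGroup E] [InnerProductSpace ℝ E]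
    [CompleteSpace E] (c : E) {δ : α → E} (hδ : MemLp δ 2 ν) (h0 : ∫ x, δ x ∂ν = 0) :
    ∫⁻ x, ‖c + δ x‖ₑ ^ 2 ∂ν = ∫⁻ _, ‖c‖ₑ ^ 2 ∂ν + ∫⁻ x, ‖δ x‖ₑ ^ 2 ∂ν := by
  have key : ∀ g : α → E, MemLp g 2 ν →
      ∫⁻ x, ‖g x‖ₑ ^ 2 ∂ν = ENNReal.ofReal (∫ x, ‖g x‖ ^ 2 ∂ν) := by
    intro g hg
    rw [ofReal_integral_eq_lintegral_ofReal hg.norm.integrable_sq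
      (ae_of_all _ fun x => by positivity)]
    refine lintegral_congr fun x => ?_
    rw [ENNReal.ofReal_pow (norm_nonneg _), ofReal_norm]
  have hc : MemLp (fun _ : α => c) 2 ν := memLp_const c
  have hi : Integrable δ ν := hδ.integrable (by norm_num)
  have hs : MemLp (fun x => c + δ x) 2 ν := hc.add hδ
  rw [key _ hs, key _ hc, key _ hδ, ← ENNReal.ofReal_add
    (integral_nonneg fun _ => by positivity) (integral_nonneg fun _ => by positivity)]
  congr 1
  simp only [norm_add_sq_real]
  have h1 : Integrable (fun x => 2 * inner ℝ c (δ x)) ν := (hi.const_inner c).const_mul 2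
  have h2 : Integrable (fun _ : α => ‖c‖ ^ 2) ν := integrable_const _
  have h3 : Integrable (fun x => ‖c‖ ^ 2 + 2 * inner ℝ c (δ x)) ν := h2.add h1
  rw [integral_add h3 hδ.norm.integrable_sq, integral_add h2 h1, integral_const_mul,
    integral_inner hi, h0, inner_zero_right, mul_zero, add_zero]

variable {Ω : Type*} {𝒬 : ℤ → Set (Set Ω)} {P Q R : Set Ω}
  {i j k m n n₀ p : ℤ} {x y : Ω} {𝕜 : Type*} [RCLike 𝕜] {f : Ω → 𝕜}
  {V : Set Ω → 𝕜} {w a : Set Ω → ℝ≥0∞}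

/-- The stopping condition relative to `P`. -/
def IsBad (a : Set Ω → ℝ≥0∞) (V : Set Ω → 𝕜) (P R : Set Ω) : Prop :=
  4 * a P < a R ∨ 8 * a P < ‖V R - V P‖ₑ

/-- The maximal elements of the tree, strictly inside `P`, that satisfy the stopping condition. -/
def stopped (𝒬 : ℤ → Set (Set Ω)) (a : Set Ω → ℝ≥0∞) (V : Set Ω → 𝕜) (P : Set Ω) : Set (Set Ω) :=
  {Q | Maximal (fun R => R ∈ tree 𝒬 ∧ R ⊂ P ∧ IsBad a V P R) Q}

/-- No stopping at `x` in the generations `p ≤ j < n`. -/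
def NotStopped (𝒬 : ℤ → Set (Set Ω)) (a : Set Ω → ℝ≥0∞) (V : Set Ω → 𝕜) (P : Set Ω) (p n : ℤ)
    (x : Ω) : Prop :=
  ∀ j, p ≤ j → j < n → ¬ IsBad a V P (cell 𝒬 j x)

open scoped Classical in
/-- The martingale `V - V P`, stopped at the first time that the stopping condition holds. -/
def stoppedSum (𝒬 : ℤ → Set (Set Ω)) (a : Set Ω → ℝ≥0∞) (V : Set Ω → 𝕜) (P : Set Ω) (p n : ℤ)
    (x : Ω) : 𝕜 :=
  ∑ k ∈ Finset.Ico p n, if NotStopped 𝒬 a V P p (k + 1) x then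
    V (cell 𝒬 (k + 1) x) - V (cell 𝒬 k x) else 0

theorem not_isBad_self : ¬ IsBad a V P P := by
  rintro (h | h)
  · exact absurd h (not_lt.2 (le_mul_of_one_le_left' (by norm_num)))
  · simp at h

theorem NotStopped.mono (h : NotStopped 𝒬 a V P p n x) (hmn : m ≤ n) :
    NotStopped 𝒬 a V P p m x := fun j h1 h2 => h j h1 (h2.trans_le hmn)

theorem notStopped_self : NotStopped 𝒬 a V P p p x := fun _ h1 h2 => absurd h1 (not_le.2 h2)

theorem NotStopped.succ (h : NotStopped 𝒬 a V P p n x) (hn : ¬ IsBad a V P (cell 𝒬 n x)) :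
    NotStopped 𝒬 a V P p (n + 1) x := by
  intro j h1 h2
  rcases (show j ≤ n by omega).lt_or_eq with h' | rfl
  · exact h j h1 h'
  · exact hn

theorem stoppedSum_succ_of_notStopped (hpn : p ≤ n) (h : NotStopped 𝒬 a V P p (n + 1) x) :
    stoppedSum 𝒬 a V P p (n + 1) x =
      stoppedSum 𝒬 a V P p n x + (V (cell 𝒬 (n + 1) x) - V (cell 𝒬 n x)) := by
  rw [stoppedSum, stoppedSum, sum_Ico_add_one _ hpn, if_pos h]

theorem stoppedSum_succ_of_not (hpn : p ≤ n) (h : ¬ NotStopped 𝒬 a V P p (n + 1) x) :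
    stoppedSum 𝒬 a V P p (n + 1) x = stoppedSum 𝒬 a V P p n x := by
  rw [stoppedSum, stoppedSum, sum_Ico_add_one _ hpn, if_neg h, add_zero]

theorem exists_first_of_not_notStopped (hpn : p ≤ n) (h : ¬ NotStopped 𝒬 a V P p (n + 1) x) :
    ∃ j, p ≤ j ∧ j ≤ n ∧ NotStopped 𝒬 a V P p j x ∧ IsBad a V P (cell 𝒬 j x) := by
  induction n, hpn using Int.leInduction with
  | base =>
    refine ⟨p, le_rfl, le_rfl, notStopped_self, ?_⟩
    by_contra hb
    exact h (notStopped_self.succ hb)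
  | succ n hn ih =>
    by_cases h' : NotStopped 𝒬 a V P p (n + 1) x
    · refine ⟨n + 1, by omega, le_rfl, h', ?_⟩
      by_contra hb
      exact h (h'.succ hb)
    · obtain ⟨j, h1, h2, h3⟩ := ih h'
      exact ⟨j, h1, by omega, h3⟩

/-- The jump into the first bad cell is included, since it only requires earlier cells to be good;
every later jump is suppressed. -/
theorem stoppedSum_eq_of_isBad (hpj : p ≤ j) (hjn : j ≤ n) (hbad : IsBad a V P (cell 𝒬 j x)) :
    stoppedSum 𝒬 a V P p n x = stoppedSum 𝒬 a V P p j x := by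
  induction n, hjn using Int.leInduction with
  | base => rfl
  | succ n hn ih =>
    rw [stoppedSum_succ_of_not (hpj.trans hn) (fun h => h j hpj (by omega) hbad), ih]

variable [MeasurableSpace Ω] {μ : Measure Ω}

/-- `V` assigns to the elements of the tree the values of a martingale whose differences, from the
generation `n₀` on, are controlled by the averages of `‖f‖` and by the weights `w` of a Carleson
sequence. -/
structure IsCarlesonTransform (μ : Measure Ω) (𝒬 : ℤ → Set (Set Ω)) (n₀ : ℤ) (f : Ω → 𝕜)
    (w : Set Ω → ℝ≥0∞) (V : Set Ω → 𝕜) : Prop where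
  le_one : ∀ Q ∈ tree 𝒬, w Q ≤ 1
  tsum_le : ∀ P ∈ tree 𝒬,
    ∑' Q : {Q : Set Ω // Q ∈ tree 𝒬 ∧ Q ⊆ P}, w Q ^ 2 * μ (Q : Set Ω) ≤ μ P
  enorm_sub_le : ∀ n ≥ n₀, ∀ x, ‖V (cell 𝒬 (n + 1) x) - V (cell 𝒬 n x)‖ₑ ≤
    (⨍⁻ y in cell 𝒬 n x, ‖f y‖ₑ ∂μ) * w (cell 𝒬 n x)
  setIntegral_eq : ∀ n ≥ n₀, ∀ R ∈ 𝒬 n,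
    ∫ x in R, (V (cell 𝒬 (n + 1) x) - V (cell 𝒬 n x)) ∂μ = 0

/-- Predictability: whether the jump from generation `n` to `n + 1` is taken depends only on the
cell of generation `n`. -/
theorem NotStopped.congr (ht : IsMartingaleTree μ 𝒬) (hxy : cell 𝒬 n x = cell 𝒬 n y)
    (h : NotStopped 𝒬 a V P p (n + 1) x) : NotStopped 𝒬 a V P p (n + 1) y := by
  intro j h1 h2
  rw [← ht.cell_congr (by omega) hxy]
  exact h j h1 h2

theorem stoppedSum_eq_of_notStopped (ht : IsMartingaleTree μ 𝒬) (hP : P ∈ 𝒬 p) (hx : x ∈ P)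
    (hpn : p ≤ n) (h : NotStopped 𝒬 a V P p n x) :
    stoppedSum 𝒬 a V P p n x = V (cell 𝒬 n x) - V P := by
  induction n, hpn using Int.leInduction with
  | base => simp [stoppedSum, ht.cell_eq hP hx]
  | succ n hn ih =>
    rw [stoppedSum_succ_of_notStopped hn h, ih (h.mono (by omega))]
    ring

theorem stoppedSum_congr (ht : IsMartingaleTree μ 𝒬) (h : cell 𝒬 n x = cell 𝒬 n y) :
    stoppedSum 𝒬 a V P p n x = stoppedSum 𝒬 a V P p n y := by
  classical
  refine Finset.sum_congr rfl fun k hk => ?_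
  have hk' := (Finset.mem_Ico.1 hk).2
  have h1 := ht.cell_congr (show k + 1 ≤ n by omega) h
  have h2 := ht.cell_congr (show k ≤ n by omega) h
  have h3 : NotStopped 𝒬 a V P p (k + 1) x ↔ NotStopped 𝒬 a V P p (k + 1) y :=
    ⟨NotStopped.congr ht h2, NotStopped.congr ht h2.symm⟩
  exact if_congr h3 (by rw [h1, h2]) rfl

/-- A tree element through `x` strictly inside `P` has generation at least `p`, so a bad one larger
than the first bad cell would have occurred earlier. -/
theorem cell_mem_stopped (ht : IsMartingaleTree μ 𝒬) (hP : P ∈ 𝒬 p) (hx : x ∈ P) (hpj : p ≤ j)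
    (h : NotStopped 𝒬 a V P p j x) (hbad : IsBad a V P (cell 𝒬 j x)) :
    cell 𝒬 j x ∈ stopped 𝒬 a V P := by
  have hsub := ht.cell_subset_of_mem hP hpj hx
  refine ⟨⟨ht.cell_mem_tree j x, hsub.ssubset_of_ne fun he => ?_, hbad⟩, ?_⟩
  · rw [he] at hbad
    exact not_isBad_self hbad
  · rintro R ⟨hR, hRP, hRbad⟩ hle
    have hxR : x ∈ R := hle (ht.mem_cell j x)
    obtain ⟨i, hi⟩ := Set.mem_iUnion.1 hR
    rw [← ht.cell_eq hi hxR] at hRbad hRP ⊢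
    have hpi : p ≤ i := by
      by_contra hlt
      refine hRP.not_subset ?_
      conv_lhs => rw [← ht.cell_eq hP hx]
      exact ht.cell_anti (by omega) x
    by_contra hsub
    refine h i hpi ?_ hRbad
    by_contra hij
    exact hsub (ht.cell_anti (by omega) x)

theorem exists_first_of_isBad (ht : IsMartingaleTree μ 𝒬) (hP : P ∈ 𝒬 p) (hR : R ∈ tree 𝒬)
    (hRP : R ⊂ P) (hx : x ∈ R) (hbad : IsBad a V P R) :
    ∃ j, p ≤ j ∧ NotStopped 𝒬 a V P p j x ∧ IsBad a V P (cell 𝒬 j x) ∧ R ⊆ cell 𝒬 j x := by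
  obtain ⟨i, hi⟩ := Set.mem_iUnion.1 hR
  have hpi : p ≤ i := by
    by_contra hlt
    exact hRP.not_subset (ht.subset_of_mem hP hi (by omega) (hRP.subset hx) hx)
  obtain ⟨j, h1, h2, h3, h4⟩ := exists_first_of_not_notStopped (𝒬 := 𝒬) (a := a) (V := V) (P := P)
    (x := x) hpi (fun h => h i hpi (by omega) (by rwa [ht.cell_eq hi hx]))
  refine ⟨j, h1, h3, h4, ?_⟩
  rw [← ht.cell_eq hi hx]
  exact ht.cell_anti h2 x

theorem exists_cell_eq_of_mem_stopped (ht : IsMartingaleTree μ 𝒬) (hP : P ∈ 𝒬 p)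
    (hQ : Q ∈ stopped 𝒬 a V P) (hx : x ∈ Q) :
    ∃ j, p ≤ j ∧ NotStopped 𝒬 a V P p j x ∧ cell 𝒬 j x = Q := by
  obtain ⟨j, h1, h2, h3, h4⟩ := exists_first_of_isBad ht hP hQ.1.1 hQ.1.2.1 hx hQ.1.2.2
  refine ⟨j, h1, h2, (Set.Subset.antisymm ?_ h4)⟩
  exact hQ.2 (cell_mem_stopped ht hP (hQ.1.2.1.subset hx) h1 h2 h3).1 h4

theorem notStopped_of_notMem (ht : IsMartingaleTree μ 𝒬) (hP : P ∈ 𝒬 p) (hx : x ∈ P)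
    (h : x ∉ ⋃₀ stopped 𝒬 a V P) (n : ℤ) : NotStopped 𝒬 a V P p n x := by
  by_contra hn
  obtain ⟨j, hpj, hjn, hbad⟩ : ∃ j, p ≤ j ∧ j < n ∧ IsBad a V P (cell 𝒬 j x) := by
    simpa [NotStopped] using hn
  obtain ⟨i, h1, h2, h3, h4⟩ := exists_first_of_not_notStopped (𝒬 := 𝒬) (a := a) (V := V) (P := P)
    (x := x) hpj (fun h => h j hpj (by omega) hbad)
  exact h ⟨_, cell_mem_stopped ht hP hx h1 h3 h4, ht.mem_cell i x⟩

theorem stopped_disjoint (ht : IsMartingaleTree μ 𝒬) (hQ : Q ∈ stopped 𝒬 a V P)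
    (hR : R ∈ stopped 𝒬 a V P) (h : Q ≠ R) : Disjoint Q R := by
  rw [Set.disjoint_left]
  intro x hxQ hxR
  rcases ht.subset_or_subset hQ.1.1 hR.1.1 hxQ hxR with h' | h'
  · exact h (h'.antisymm (hQ.2 hR.1 h'))
  · exact h ((hR.2 hQ.1 h').antisymm h')

end MartingalePara

/-! ### Uniform and `L²` bounds for the stopped martingale -/

namespace MartingalePara

/-- The average of `‖f‖` over `Q`. -/
def avgNorm {Ω : Type*} [MeasurableSpace Ω] (μ : Measure Ω) {𝕜 : Type*} [RCLike 𝕜] (f : Ω → 𝕜)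
    (Q : Set Ω) : ℝ≥0∞ :=
  ⨍⁻ y in Q, ‖f y‖ₑ ∂μ

variable {Ω : Type*} [MeasurableSpace Ω] {μ : Measure Ω} {𝒬 : ℤ → Set (Set Ω)} {P Q R : Set Ω}
  {i j k m n n₀ p : ℤ} {x y : Ω} {𝕜 : Type*} [RCLike 𝕜] {f : Ω → 𝕜}
  {V : Set Ω → 𝕜} {w : Set Ω → ℝ≥0∞}

theorem avgNorm_ne_top (ht : IsMartingaleTree μ 𝒬) (hf : Integrable f μ) (hQ : Q ∈ tree 𝒬) :
    avgNorm μ f Q ≠ ∞ := by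
  rw [avgNorm, setLAverage_eq]
  refine ENNReal.div_ne_top ?_ (ht.measure_ne_zero hQ)
  exact ((setLIntegral_le_lintegral _ _).trans_lt hf.hasFiniteIntegral).ne

theorem avgNorm_mul_measure (ht : IsMartingaleTree μ 𝒬) (f : Ω → 𝕜) (hQ : Q ∈ tree 𝒬) :
    avgNorm μ f Q * μ Q = ∫⁻ y in Q, ‖f y‖ₑ ∂μ := by
  rw [avgNorm, setLAverage_eq, ENNReal.div_mul_cancel (ht.measure_ne_zero hQ) (ht.measure_ne_top hQ)]

/-- Before a jump the current cell is good, so the sum is at most `8⟨|f|⟩_P` and the jump at most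
`4⟨|f|⟩_P`, because `w ≤ 1`. -/
theorem enorm_stoppedSum_le (ht : IsMartingaleTree μ 𝒬)
    (hV : IsCarlesonTransform μ 𝒬 n₀ f w V) (hp : n₀ ≤ p) (hP : P ∈ 𝒬 p) (hx : x ∈ P)
    (hpn : p ≤ n) :
    ‖stoppedSum 𝒬 (avgNorm μ f) V P p n x‖ₑ ≤ 12 * avgNorm μ f P := by
  induction n, hpn using Int.leInduction with
  | base => simp [stoppedSum]
  | succ n hn ih =>
    by_cases h : NotStopped 𝒬 (avgNorm μ f) V P p (n + 1) x
    · have hb := h n hn (by omega)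
      simp only [IsBad, not_or, not_lt] at hb
      rw [stoppedSum_succ_of_notStopped hn h,
        stoppedSum_eq_of_notStopped ht hP hx hn (h.mono (by omega))]
      calc _ ≤ _ := enorm_add_le _ _
        _ ≤ 8 * avgNorm μ f P + 4 * avgNorm μ f P * 1 :=
          add_le_add hb.2 ((hV.enorm_sub_le n (hp.trans hn) x).trans
            (mul_le_mul' hb.1 (hV.le_one _ (ht.cell_mem_tree n x))))
        _ = _ := by rw [mul_one, ← add_mul]; norm_num
    · rwa [stoppedSum_succ_of_not hn h]

theorem measurable_stoppedSum [SigmaFinite μ] (ht : IsMartingaleTree μ 𝒬) (a : Set Ω → ℝ≥0∞)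
    (V : Set Ω → 𝕜) (P : Set Ω) (p n : ℤ) : Measurable (stoppedSum 𝒬 a V P p n) :=
  ht.measurable_of_cell fun _ _ => stoppedSum_congr ht

theorem enorm_sub_apply_le (ht : IsMartingaleTree μ 𝒬)
    (hV : IsCarlesonTransform μ 𝒬 n₀ f w V) (hn : n₀ ≤ n) (hR : R ∈ 𝒬 n) (hx : x ∈ R)
    (ha : avgNorm μ f R ≤ 4 * avgNorm μ f P) :
    ‖V (cell 𝒬 (n + 1) x) - V (cell 𝒬 n x)‖ₑ ≤ 4 * avgNorm μ f P * w R := by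
  refine (hV.enorm_sub_le n hn x).trans ?_
  rw [ht.cell_eq hR hx]
  exact mul_le_mul_left ha _

-- On a cell `R` the stopped sum is constant and its next jump has mean zero, so the squares add. A
-- set persisting to the next generation has no jump and is charged nothing, which prevents multiple
-- counting of its weight.
open scoped Classical in
theorem setLIntegral_stoppedSum_succ_le [SigmaFinite μ] (ht : IsMartingaleTree μ 𝒬)
    (hf : Integrable f μ) (hV : IsCarlesonTransform μ 𝒬 n₀ f w V) (hp : n₀ ≤ p) (hP : P ∈ 𝒬 p)
    (hpn : p ≤ n) (hR : R ∈ 𝒬 n) :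
    ∫⁻ x in R, ‖stoppedSum 𝒬 (avgNorm μ f) V P p (n + 1) x‖ₑ ^ 2 ∂μ ≤
      ∫⁻ x in R, ‖stoppedSum 𝒬 (avgNorm μ f) V P p n x‖ₑ ^ 2 ∂μ +
        (4 * avgNorm μ f P) ^ 2 * (if R ∈ 𝒬 (n + 1) then 0 else w R ^ 2 * μ R) := by
  obtain ⟨x₀, hx₀⟩ := ht.nonempty hR
  have hcell : ∀ x ∈ R, cell 𝒬 n x = cell 𝒬 n x₀ := fun x hx =>
    (ht.cell_eq hR hx).trans (ht.cell_eq hR hx₀).symm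
  have hRm := ht.measurableSet n R hR
  have hRt : R ∈ tree 𝒬 := Set.mem_iUnion.2 ⟨n, hR⟩
  have hPt : P ∈ tree 𝒬 := Set.mem_iUnion.2 ⟨p, hP⟩
  by_cases hg : NotStopped 𝒬 (avgNorm μ f) V P p (n + 1) x₀
  · have hb := hg n hpn (by omega)
    simp only [IsBad, not_or, not_lt] at hb
    have ha := hb.1
    rw [ht.cell_eq hR hx₀] at ha
    have : IsFiniteMeasure (μ.restrict R) := ⟨by
      rw [Measure.restrict_apply_univ]; exact ht.measure_lt_top n R hR⟩
    have hδm : Measurable (fun x => V (cell 𝒬 (n + 1) x) - V (cell 𝒬 n x)) := by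
      refine ht.measurable_of_cell (n := n + 1) fun x y hxy => ?_
      rw [hxy, ht.cell_congr (by omega) hxy]
    have hδb : ∀ x ∈ R, ‖V (cell 𝒬 (n + 1) x) - V (cell 𝒬 n x)‖ₑ ≤ 4 * avgNorm μ f P * w R :=
      fun x hx => enorm_sub_apply_le ht hV (hp.trans hpn) hR hx ha
    have hfin : 4 * avgNorm μ f P * w R ≠ ∞ := ENNReal.mul_ne_top
      (ENNReal.mul_ne_top (by norm_num) (avgNorm_ne_top ht hf hPt))
      (ne_top_of_le_ne_top ENNReal.one_ne_top (hV.le_one R hRt))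
    have hδ : MemLp (fun x => V (cell 𝒬 (n + 1) x) - V (cell 𝒬 n x)) 2 (μ.restrict R) := by
      refine MemLp.of_bound hδm.aestronglyMeasurable (4 * avgNorm μ f P * w R).toReal ?_
      refine (ae_restrict_iff' hRm).2 (ae_of_all _ fun x hx => ?_)
      rw [← toReal_enorm]
      exact ENNReal.toReal_mono hfin (hδb x hx)
    have h1 : ∫⁻ x in R, ‖stoppedSum 𝒬 (avgNorm μ f) V P p (n + 1) x‖ₑ ^ 2 ∂μ =
        ∫⁻ x in R, ‖stoppedSum 𝒬 (avgNorm μ f) V P p n x₀ +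
          (V (cell 𝒬 (n + 1) x) - V (cell 𝒬 n x))‖ₑ ^ 2 ∂μ := by
      refine setLIntegral_congr_fun hRm fun x hx => ?_
      rw [stoppedSum_succ_of_notStopped hpn (hg.congr ht (hcell x hx).symm),
        stoppedSum_congr ht (hcell x hx)]
    have h2 : ∫⁻ x in R, ‖stoppedSum 𝒬 (avgNorm μ f) V P p n x‖ₑ ^ 2 ∂μ =
        ∫⁻ _ in R, ‖stoppedSum 𝒬 (avgNorm μ f) V P p n x₀‖ₑ ^ 2 ∂μ := by
      refine setLIntegral_congr_fun hRm fun x hx => ?_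
      rw [stoppedSum_congr ht (hcell x hx)]
    rw [h1, h2, lintegral_enorm_sq_const_add _ hδ (hV.setIntegral_eq n (hp.trans hpn) R hR)]
    gcongr
    split_ifs with hc
    · rw [mul_zero, setLIntegral_congr_fun (g := fun _ => 0) hRm, lintegral_zero]
      intro x hx
      simp [ht.cell_eq hR hx, ht.cell_eq hc hx]
    · rw [← mul_assoc, ← mul_pow, ← setLIntegral_const]
      exact setLIntegral_mono' hRm fun x hx => pow_le_pow_left' (hδb x hx) 2
  · refine le_add_right (le_of_eq (setLIntegral_congr_fun hRm fun x hx => ?_))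
    rw [stoppedSum_succ_of_not hpn fun h => hg (h.congr ht (hcell x hx))]

open scoped Classical in
theorem setLIntegral_stoppedSum_le_sum [SigmaFinite μ] (ht : IsMartingaleTree μ 𝒬)
    (hf : Integrable f μ) (hV : IsCarlesonTransform μ 𝒬 n₀ f w V) (hp : n₀ ≤ p) (hP : P ∈ 𝒬 p)
    (hpn : p ≤ n) :
    ∫⁻ x in P, ‖stoppedSum 𝒬 (avgNorm μ f) V P p n x‖ₑ ^ 2 ∂μ ≤
      (4 * avgNorm μ f P) ^ 2 * ∑ k ∈ Finset.Ico p n,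
        ∑' Q : {Q : Set Ω // Q ∈ tree 𝒬 ∧ Q ⊆ P},
          if (Q : Set Ω) ∈ 𝒬 k ∧ (Q : Set Ω) ∉ 𝒬 (k + 1) then w Q ^ 2 * μ (Q : Set Ω) else 0 := by
  induction n, hpn using Int.leInduction with
  | base => simp [stoppedSum]
  | succ n hn ih =>
    have hs : ∀ x ∈ P, cell 𝒬 n x ⊆ P := fun x hx => ht.cell_subset_of_mem hP hn hx
    rw [sum_Ico_add_one _ hn, mul_add]
    refine le_trans ?_ (add_le_add_left ih _)
    rw [ht.lintegral_eq_tsum hs, ht.lintegral_eq_tsum hs]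
    refine (ENNReal.tsum_le_tsum fun R => setLIntegral_stoppedSum_succ_le ht hf hV hp hP hn
      R.2.1).trans ?_
    rw [ENNReal.tsum_add, ENNReal.tsum_mul_left]
    gcongr
    let φ : {R | R ∈ 𝒬 n ∧ R ⊆ P} → {Q : Set Ω // Q ∈ tree 𝒬 ∧ Q ⊆ P} :=
      fun R => ⟨R, Set.mem_iUnion.2 ⟨n, R.2.1⟩, R.2.2⟩
    have hφ : Function.Injective φ := fun R S h => Subtype.ext (congrArg (fun T => T.1) h)
    refine le_trans (le_of_eq ?_) (ENNReal.tsum_comp_le_tsum_of_injective hφ _)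
    refine tsum_congr fun R => ?_
    have hR : (φ R : Set Ω) ∈ 𝒬 n := R.2.1
    by_cases hc : (φ R : Set Ω) ∈ 𝒬 (n + 1)
    · rw [if_pos hc, if_neg (fun h => h.2 hc)]
    · rw [if_neg hc, if_pos ⟨hR, hc⟩]

/-- The `L²` bound for the stopped martingale. -/
theorem setLIntegral_stoppedSum_le [SigmaFinite μ] (ht : IsMartingaleTree μ 𝒬)
    (hf : Integrable f μ) (hV : IsCarlesonTransform μ 𝒬 n₀ f w V) (hp : n₀ ≤ p) (hP : P ∈ 𝒬 p)
    (hpn : p ≤ n) :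
    ∫⁻ x in P, ‖stoppedSum 𝒬 (avgNorm μ f) V P p n x‖ₑ ^ 2 ∂μ ≤
      (4 * avgNorm μ f P) ^ 2 * μ P := by
  classical
  refine (setLIntegral_stoppedSum_le_sum ht hf hV hp hP hpn).trans ?_
  rw [← Summable.tsum_finsetSum fun _ _ => ENNReal.summable]
  refine mul_le_mul_right ((ENNReal.tsum_le_tsum fun Q => ?_).trans
    (hV.tsum_le P (Set.mem_iUnion.2 ⟨p, hP⟩))) _
  rw [← Finset.sum_filter, Finset.sum_const, nsmul_eq_mul]
  -- Each `Q` is charged only at its last generation, hence at most once.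
  refine mul_le_of_le_one_left' ?_
  rw [Nat.cast_le_one, Finset.card_le_one]
  intro k hk l hl
  simp only [Finset.mem_filter] at hk hl
  rcases lt_trichotomy k l with h | h | h
  · exact (hk.2.2 (ht.mem_of_le_of_le (by omega) (by omega) hk.2.1 hl.2.1 : _ ∈ 𝒬 (k + 1))).elim
  · exact h
  · exact (hl.2.2 (ht.mem_of_le_of_le (by omega) (by omega) hl.2.1 hk.2.1 : _ ∈ 𝒬 (l + 1))).elim

end MartingalePara

/-! ### Size of the stopped sets and convergence outside them -/

namespace MartingalePara

variable {Ω : Type*} [MeasurableSpace Ω] {μ : Measure Ω} {𝒬 : ℤ → Set (Set Ω)} {P Q R : Set Ω}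
  {i j k m n n₀ p : ℤ} {x y : Ω} {𝕜 : Type*} [RCLike 𝕜] {f : Ω → 𝕜}
  {V : Set Ω → 𝕜} {w : Set Ω → ℝ≥0∞}

/-- Chebyshev at level `8⟨|f|⟩_P` against the `L²` bound: the factor is `(8 / 4)² = 4`. If the
average vanishes, the uniform bound makes the exceptional set empty. -/
theorem measure_setOf_lt_enorm_stoppedSum_le [SigmaFinite μ] (ht : IsMartingaleTree μ 𝒬)
    (hf : Integrable f μ) (hV : IsCarlesonTransform μ 𝒬 n₀ f w V) (hp : n₀ ≤ p) (hP : P ∈ 𝒬 p)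
    (hpn : p ≤ n) :
    4 * μ {x | x ∈ P ∧ 8 * avgNorm μ f P < ‖stoppedSum 𝒬 (avgNorm μ f) V P p n x‖ₑ} ≤ μ P := by
  have hPt : P ∈ tree 𝒬 := Set.mem_iUnion.2 ⟨p, hP⟩
  have hPm := ht.measurableSet_of_mem_tree hPt
  set a := avgNorm μ f P with ha
  have hat : a ≠ ∞ := avgNorm_ne_top ht hf hPt
  set h := stoppedSum 𝒬 (avgNorm μ f) V P p n with hh
  by_cases h0 : a = 0
  · have : {x | x ∈ P ∧ 8 * a < ‖h x‖ₑ} = ∅ := by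
      refine Set.eq_empty_of_forall_notMem fun x hx => ?_
      have := enorm_stoppedSum_le ht hV hp hP hx.1 hpn
      rw [← ha, ← hh, h0, mul_zero] at this
      exact not_lt_zero (hx.2.trans_le this)
    simp [this]
  · have hm : Measurable h := measurable_stoppedSum ht _ V P p n
    have h1 := (mul_meas_ge_le_lintegral₀ (μ := μ.restrict P)
      ((hm.enorm.pow_const 2).aemeasurable) ((8 * a) ^ 2)).trans
      (setLIntegral_stoppedSum_le ht hf hV hp hP hpn)
    have h2 : μ {x | x ∈ P ∧ 8 * a < ‖h x‖ₑ} ≤ μ.restrict P {x | (8 * a) ^ 2 ≤ ‖h x‖ₑ ^ 2} := by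
      rw [Measure.restrict_apply' hPm]
      exact measure_mono fun x hx => ⟨pow_le_pow_left' hx.2.le 2, hx.1⟩
    have h3 : (4 * a) ^ 2 * (4 * μ {x | x ∈ P ∧ 8 * a < ‖h x‖ₑ}) ≤ (4 * a) ^ 2 * μ P := by
      refine le_trans (le_of_eq ?_) ((mul_le_mul_right h2 _).trans h1)
      rw [mul_pow, mul_pow]
      ring
    refine (ENNReal.mul_le_mul_iff_right ?_ ?_).1 h3
    · simp [h0]
    · exact ENNReal.pow_ne_top (ENNReal.mul_ne_top (by norm_num) hat)

/-- The selected sets are disjoint in `P` and each carries more than `4⟨|f|⟩_P` times its measure of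
the mass of `|f|`. -/
theorem measure_sUnion_stopped_avgNorm_le [SigmaFinite μ] (ht : IsMartingaleTree μ 𝒬)
    (hf : Integrable f μ) (V : Set Ω → 𝕜) (hPt : P ∈ tree 𝒬) :
    4 * μ (⋃₀ {Q | Q ∈ stopped 𝒬 (avgNorm μ f) V P ∧ 4 * avgNorm μ f P < avgNorm μ f Q}) ≤
      μ P := by
  set a := avgNorm μ f with ha
  set 𝒯 := {Q | Q ∈ stopped 𝒬 a V P ∧ 4 * a P < a Q} with h𝒯
  have hc : 𝒯.Countable := ht.countable_tree.mono fun Q hQ => hQ.1.1.1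
  have hle : ∀ Q ∈ 𝒯, a Q * μ Q ≤ a P * μ P := fun Q hQ => by
    rw [avgNorm_mul_measure ht f hQ.1.1.1, avgNorm_mul_measure ht f hPt]
    exact lintegral_mono_set hQ.1.1.2.1.subset
  by_cases h0 : a P = 0
  · have : 𝒯 = ∅ := by
      refine Set.eq_empty_of_forall_notMem fun Q hQ => ?_
      have h1 := hle Q hQ
      rw [h0, zero_mul, nonpos_iff_eq_zero, mul_eq_zero] at h1
      exact (not_lt_zero (hQ.2.trans_eq (h1.resolve_right (ht.measure_ne_zero hQ.1.1.1)))).elim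
    simp [this]
  · refine (ENNReal.mul_le_mul_iff_right h0 (avgNorm_ne_top ht hf hPt)).1 ?_
    have hd : 𝒯.PairwiseDisjoint id := fun Q hQ R hR h => stopped_disjoint ht hQ.1 hR.1 h
    have hm : ∀ Q ∈ 𝒯, MeasurableSet Q := fun Q hQ => ht.measurableSet_of_mem_tree hQ.1.1.1
    rw [measure_sUnion hc hd hm, ← mul_assoc, mul_comm (a P),
      ← ENNReal.tsum_mul_left, ha, avgNorm_mul_measure ht f hPt]
    calc _ ≤ ∑' Q : 𝒯, ∫⁻ y in (Q : Set Ω), ‖f y‖ₑ ∂μ := by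
          refine ENNReal.tsum_le_tsum fun Q => ?_
          rw [← avgNorm_mul_measure ht f Q.2.1.1.1]
          exact mul_le_mul_left Q.2.2.le _
      _ = ∫⁻ y in ⋃ Q ∈ 𝒯, Q, ‖f y‖ₑ ∂μ := (lintegral_biUnion hc hm hd _).symm
      _ ≤ _ := lintegral_mono_set (Set.iUnion₂_subset fun Q hQ => hQ.1.1.2.1.subset)

theorem measure_sUnion_stopped_le [SigmaFinite μ] (ht : IsMartingaleTree μ 𝒬)
    (hf : Integrable f μ) (hV : IsCarlesonTransform μ 𝒬 n₀ f w V) (hp : n₀ ≤ p) (hP : P ∈ 𝒬 p) :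
    μ (⋃₀ stopped 𝒬 (avgNorm μ f) V P) ≤ 2⁻¹ * μ P := by
  have hPt : P ∈ tree 𝒬 := Set.mem_iUnion.2 ⟨p, hP⟩
  set a := avgNorm μ f with ha
  -- `W i` collects the points stopped by generation `p + i` because of `V`. There the stopped sum
  -- has frozen at its large value, so the bound at the single time `p + i` applies; then `i` tends
  -- to infinity.
  let W : ℕ → Set Ω := fun i => {x | x ∈ P ∧ ∃ j, p ≤ j ∧ j ≤ p + i ∧
    NotStopped 𝒬 a V P p j x ∧ 8 * a P < ‖V (cell 𝒬 j x) - V P‖ₑ}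
  have hWmono : Monotone W := by
    rintro i i' hi x ⟨hx, j, h1, h2, h3⟩
    exact ⟨hx, j, h1, by omega, h3⟩
  have hW : ∀ i, 4 * μ (W i) ≤ μ P := by
    intro i
    refine le_trans (mul_le_mul_right (measure_mono ?_) _)
      (measure_setOf_lt_enorm_stoppedSum_le (n := p + i) ht hf hV hp hP (by omega))
    rintro x ⟨hx, j, h1, h2, h3, h4⟩
    refine ⟨hx, ?_⟩
    rwa [stoppedSum_eq_of_isBad h1 h2 (Or.inr h4), stoppedSum_eq_of_notStopped ht hP hx h1 h3]
  have hWU : 4 * μ (⋃ i, W i) ≤ μ P := by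
    rw [hWmono.measure_iUnion, ENNReal.mul_iSup]
    exact iSup_le hW
  have hsub : ⋃₀ stopped 𝒬 a V P ⊆
      ⋃₀ {Q | Q ∈ stopped 𝒬 a V P ∧ 4 * a P < a Q} ∪ ⋃ i, W i := by
    rintro x ⟨Q, hQ, hx⟩
    rcases hQ.1.2.2 with h | h
    · exact Or.inl ⟨Q, ⟨hQ, h⟩, hx⟩
    · obtain ⟨j, h1, h2, h3⟩ := exists_cell_eq_of_mem_stopped ht hP hQ hx
      rw [← h3] at h
      exact Or.inr (Set.mem_iUnion.2 ⟨(j - p).toNat, hQ.1.2.1.subset hx, j, h1, by omega, h2, h⟩)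
  have h4 : 4 * μ (⋃₀ stopped 𝒬 a V P) ≤ 4 * (2⁻¹ * μ P) := by
    calc _ ≤ 4 * (μ (⋃₀ {Q | Q ∈ stopped 𝒬 a V P ∧ 4 * a P < a Q}) + μ (⋃ i, W i)) :=
          mul_le_mul_right ((measure_mono hsub).trans (measure_union_le _ _)) _
      _ ≤ μ P + μ P := by
          rw [mul_add]
          exact add_le_add (measure_sUnion_stopped_avgNorm_le ht hf V hPt) hWU
      _ = _ := by
          rw [← mul_assoc, show (4 : ℝ≥0∞) = 2 * 2 by norm_num, mul_assoc 2 2,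
            ENNReal.mul_inv_cancel two_ne_zero ENNReal.ofNat_ne_top, mul_one, two_mul]
  exact (ENNReal.mul_le_mul_iff_right (by norm_num) (by norm_num)).1 h4

theorem setIntegral_stoppedSum_sub_eq_zero [SigmaFinite μ] (ht : IsMartingaleTree μ 𝒬)
    (hV : IsCarlesonTransform μ 𝒬 n₀ f w V) (hp : n₀ ≤ p) (hpn : p ≤ n) (hR : R ∈ 𝒬 n)
    (a : Set Ω → ℝ≥0∞) (P : Set Ω) :
    ∫ x in R, (stoppedSum 𝒬 a V P p (n + 1) x - stoppedSum 𝒬 a V P p n x) ∂μ = 0 := by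
  obtain ⟨x₀, hx₀⟩ := ht.nonempty hR
  have hcell : ∀ x ∈ R, cell 𝒬 n x = cell 𝒬 n x₀ := fun x hx =>
    (ht.cell_eq hR hx).trans (ht.cell_eq hR hx₀).symm
  have hRm := ht.measurableSet n R hR
  by_cases hg : NotStopped 𝒬 a V P p (n + 1) x₀
  · rw [← hV.setIntegral_eq n (hp.trans hpn) R hR]
    refine setIntegral_congr_fun hRm fun x hx => ?_
    simp only [stoppedSum_succ_of_notStopped hpn (hg.congr ht (hcell x hx).symm),
      add_sub_cancel_left]
  · refine setIntegral_eq_zero_of_forall_eq_zero fun x hx => ?_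
    rw [stoppedSum_succ_of_not hpn fun h => hg (h.congr ht (hcell x hx)), sub_self]

/-- Doob's theorem for a bounded martingale on the finite measure space `P`. The real-linear
functional makes it scalar; real and imaginary parts are used afterwards. -/
theorem ae_exists_tendsto_comp_stoppedSum [SigmaFinite μ] (ht : IsMartingaleTree μ 𝒬)
    (hf : Integrable f μ) (hV : IsCarlesonTransform μ 𝒬 n₀ f w V) (hp : n₀ ≤ p) (hP : P ∈ 𝒬 p)
    (L : 𝕜 →L[ℝ] ℝ) :
    ∀ᵐ x ∂μ.restrict P, ∃ c, Tendsto
      (fun i : ℕ => L (stoppedSum 𝒬 (avgNorm μ f) V P p (p + i) x)) atTop (𝓝 c) := by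
  have hPt : P ∈ tree 𝒬 := Set.mem_iUnion.2 ⟨p, hP⟩
  have hPm := ht.measurableSet_of_mem_tree hPt
  set a := avgNorm μ f with ha
  have : IsFiniteMeasure (μ.restrict P) := ⟨by
    rw [Measure.restrict_apply_univ]; exact ht.measure_lt_top p P hP⟩
  have hbd : ∀ i : ℕ, ∀ᵐ x ∂μ.restrict P,
      ‖stoppedSum 𝒬 a V P p (p + i) x‖ ≤ (12 * a P).toReal := by
    intro i
    refine (ae_restrict_iff' hPm).2 (ae_of_all _ fun x hx => ?_)
    rw [← toReal_enorm]
    exact ENNReal.toReal_mono (ENNReal.mul_ne_top (by norm_num) (avgNorm_ne_top ht hf hPt))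
      (enorm_stoppedSum_le ht hV hp hP hx (by omega))
  have hm : ∀ i : ℕ, Integrable (stoppedSum 𝒬 a V P p (p + i)) (μ.restrict P) := fun i =>
    Integrable.of_bound (measurable_stoppedSum ht _ V P p _).aestronglyMeasurable _ (hbd i)
  have hmart : Martingale (fun (i : ℕ) x => L (stoppedSum 𝒬 a V P p (p + i) x)) (ht.filtration p)
      (μ.restrict P) := by
    refine martingale_of_setIntegral_eq_succ (fun i => ?_) (fun i => L.integrable_comp (hm i))
      fun i s hs => ?_
    · exact (ht.measurable_sigmaAlgebra fun x y hxy => by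
        simp only [stoppedSum_congr ht hxy]).stronglyMeasurable
    · have hsm : MeasurableSet s := (ht.filtration p).le i s hs
      have h0 : ∫ x in s, (stoppedSum 𝒬 a V P p (p + i + 1) x - stoppedSum 𝒬 a V P p (p + i) x)
          ∂μ.restrict P = 0 := by
        rw [Measure.restrict_restrict hsm]
        -- The part of `s` inside `P` is a union of cells of generation `p + i`, so the martingale
        -- property reduces to mean zero on cells.
        refine ht.setIntegral_eq_zero (n := p + i) (fun x hx y hy => ?_) ?_ fun R hR _ => ?_
        · exact ⟨hs x hx.1 hy, ht.cell_subset_of_mem hP (by omega) hx.2 hy⟩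
        · have := ((hm (i + 1)).sub (hm i)).mono_measure
            (Measure.restrict_mono (Set.inter_subset_right (s := s)) le_rfl)
          push_cast [← add_assoc] at this
          exact this
        · exact setIntegral_stoppedSum_sub_eq_zero ht hV hp (by omega) hR a P
      have h1 : stoppedSum 𝒬 a V P p (p + (i + 1 : ℕ)) = stoppedSum 𝒬 a V P p (p + i + 1) := by
        push_cast
        rw [add_assoc]
      have hm1 := hm (i + 1)
      rw [h1] at hm1
      rw [integral_sub hm1.integrableOn (hm i).integrableOn, sub_eq_zero] at h0
      simp only [h1]
      rw [L.integral_comp_comm hm1.integrableOn, L.integral_comp_comm (hm i).integrableOn, h0]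
  set B : ℝ := ‖L‖ * (12 * a P).toReal with hB
  have hle : ∀ i : ℕ, eLpNorm (fun x => L (stoppedSum 𝒬 a V P p (p + i) x)) 1 (μ.restrict P) ≤
      (μ.restrict P Set.univ * ENNReal.ofReal B).toNNReal := by
    intro i
    rw [ENNReal.coe_toNNReal (ENNReal.mul_ne_top (measure_ne_top _ _) ENNReal.ofReal_ne_top)]
    have := eLpNorm_le_of_ae_bound (p := 1) (μ := μ.restrict P) (C := B)
      (f := fun x => L (stoppedSum 𝒬 a V P p (p + i) x)) (by
        filter_upwards [hbd i] with x hx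
        exact (L.le_opNorm _).trans (mul_le_mul_of_nonneg_left hx (norm_nonneg _)))
    simpa using this
  exact hmart.submartingale.exists_ae_tendsto_of_bdd hle

theorem tendsto_of_tendsto_nat {E : Type*} [TopologicalSpace E] {g : ℤ → E} {c : E}
    (h : Tendsto (fun i : ℕ => g (p + i)) atTop (𝓝 c)) : Tendsto g atTop (𝓝 c) := by
  have h2 : Tendsto (fun n : ℤ => (n - p).toNat) atTop atTop := by
    refine tendsto_atTop.2 fun j => ?_
    filter_upwards [eventually_ge_atTop (p + j)] with m hm
    omega
  refine (h.comp h2).congr' ?_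
  filter_upwards [eventually_ge_atTop p] with m hm
  simp only [Function.comp_apply]
  congr 1
  omega

/-- Almost everywhere on `P` outside the stopped elements, `V` converges along the tree. -/
theorem ae_exists_tendsto_of_notMem [SigmaFinite μ] (ht : IsMartingaleTree μ 𝒬)
    (hf : Integrable f μ) (hV : IsCarlesonTransform μ 𝒬 n₀ f w V) (hp : n₀ ≤ p) (hP : P ∈ 𝒬 p) :
    ∀ᵐ x ∂μ, x ∈ P → x ∉ ⋃₀ stopped 𝒬 (avgNorm μ f) V P →
      ∃ c, Tendsto (fun n => V (cell 𝒬 n x)) atTop (𝓝 c) ∧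
        ‖c - V P‖ₑ ≤ 12 * avgNorm μ f P := by
  have hre := (ae_restrict_iff' (ht.measurableSet p P hP)).1
    (ae_exists_tendsto_comp_stoppedSum ht hf hV hp hP RCLike.reCLM)
  have him := (ae_restrict_iff' (ht.measurableSet p P hP)).1
    (ae_exists_tendsto_comp_stoppedSum ht hf hV hp hP RCLike.imCLM)
  filter_upwards [hre, him] with x h1 h2 hx hns
  obtain ⟨c, hc⟩ := h1 hx
  obtain ⟨d, hd⟩ := h2 hx
  have h3 : Tendsto (fun i : ℕ => stoppedSum 𝒬 (avgNorm μ f) V P p (p + i) x) atTop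
      (𝓝 ((c : 𝕜) + d * RCLike.I)) := by
    have h4 := ((RCLike.continuous_ofReal (K := 𝕜)).tendsto c).comp hc
    have h5 := ((RCLike.continuous_ofReal (K := 𝕜)).tendsto d).comp hd
    refine (h4.add (h5.mul_const RCLike.I)).congr fun i => ?_
    simp [RCLike.re_add_im]
  have h6 : ∀ i : ℕ, stoppedSum 𝒬 (avgNorm μ f) V P p (p + i) x = V (cell 𝒬 (p + i) x) - V P :=
    fun i => stoppedSum_eq_of_notStopped ht hP hx (by omega) (notStopped_of_notMem ht hP hx hns _)
  refine ⟨(c : 𝕜) + d * RCLike.I + V P, ?_, ?_⟩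
  · refine tendsto_of_tendsto_nat (p := p) ((h3.add_const (V P)).congr fun i => ?_)
    rw [h6, sub_add_cancel]
  · rw [add_sub_cancel_right]
    exact le_of_tendsto h3.enorm (Eventually.of_forall fun i =>
      enorm_stoppedSum_le ht hV hp hP hx (by omega))

theorem enorm_sub_le_of_mem_stopped (ht : IsMartingaleTree μ 𝒬)
    (hV : IsCarlesonTransform μ 𝒬 n₀ f w V) (hp : n₀ ≤ p) (hP : P ∈ 𝒬 p)
    (hQ : Q ∈ stopped 𝒬 (avgNorm μ f) V P) : ‖V Q - V P‖ₑ ≤ 12 * avgNorm μ f P := by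
  obtain ⟨x, hx⟩ := ht.nonempty_of_mem_tree hQ.1.1
  obtain ⟨j, h1, h2, rfl⟩ := exists_cell_eq_of_mem_stopped ht hP hQ hx
  have hxP := hQ.1.2.1.subset hx
  rw [← stoppedSum_eq_of_notStopped ht hP hxP h1 h2]
  exact enorm_stoppedSum_le ht hV hp hP hxP h1

end MartingalePara

/-! ### The stopping family, its sparseness and the domination of `V` -/

namespace MartingalePara

/-- The generations of the stopping family started at `Q₀`. -/
def stopFamily {Ω : Type*} {𝕜 : Type*} [RCLike 𝕜] (𝒬 : ℤ → Set (Set Ω)) (a : Set Ω → ℝ≥0∞)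
    (V : Set Ω → 𝕜) (Q₀ : Set Ω) : ℕ → Set (Set Ω)
  | 0 => {Q₀}
  | j + 1 => {Q | ∃ P ∈ stopFamily 𝒬 a V Q₀ j, Q ∈ stopped 𝒬 a V P}

theorem stopFamily_subset {Ω : Type*} {𝕜 : Type*} [RCLike 𝕜] {𝒬 : ℤ → Set (Set Ω)}
    {a : Set Ω → ℝ≥0∞} {V : Set Ω → 𝕜} {P Q₀ : Set Ω} {j : ℕ} (hQ₀ : Q₀ ∈ tree 𝒬)
    (hP : P ∈ stopFamily 𝒬 a V Q₀ j) :
    P ∈ tree 𝒬 ∧ P ⊆ Q₀ := by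
  induction j generalizing P with
  | zero =>
    obtain rfl : P = Q₀ := hP
    exact ⟨hQ₀, subset_rfl⟩
  | succ j ih =>
    obtain ⟨P', hP', hP⟩ := hP
    exact ⟨hP.1.1, hP.1.2.1.subset.trans (ih hP').2⟩

variable {Ω : Type*} [MeasurableSpace Ω] {μ : Measure Ω} {𝒬 : ℤ → Set (Set Ω)} {P Q R Q₀ : Set Ω}
  {m n n₀ p : ℤ} {x y : Ω} {𝕜 : Type*} [RCLike 𝕜] {f : Ω → 𝕜} {b : Set Ω → Ω → 𝕜}
  {V : Set Ω → 𝕜} {w a : Set Ω → ℝ≥0∞} {i j : ℕ}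

theorem IsMartingaleTree.exists_ge_of_subset (ht : IsMartingaleTree μ 𝒬) (hQ₀ : Q₀ ∈ 𝒬 n₀)
    (hP : P ∈ tree 𝒬) (h : P ⊆ Q₀) : ∃ p ≥ n₀, P ∈ 𝒬 p := by
  obtain ⟨i, hi⟩ := Set.mem_iUnion.1 hP
  rcases le_total n₀ i with h' | h'
  · exact ⟨i, h', hi⟩
  · obtain ⟨x, hx⟩ := ht.nonempty hi
    exact ⟨n₀, le_rfl, h.antisymm (ht.subset_of_mem hQ₀ hi h' (h hx) hx) ▸ hQ₀⟩

theorem stopFamily_disjoint (ht : IsMartingaleTree μ 𝒬) (hP : P ∈ stopFamily 𝒬 a V Q₀ j)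
    (hQ : Q ∈ stopFamily 𝒬 a V Q₀ j) (h : P ≠ Q) : Disjoint P Q := by
  induction j generalizing P Q with
  | zero => exact (h (Eq.trans (b := Q₀) hP (Eq.symm hQ))).elim
  | succ j ih =>
    obtain ⟨P', hP', hP⟩ := hP
    obtain ⟨Q', hQ', hQ⟩ := hQ
    by_cases he : P' = Q'
    · subst he
      exact stopped_disjoint ht hP hQ h
    · exact (ih hP' hQ' he).mono hP.1.2.1.subset hQ.1.2.1.subset

/-- Compare `P` with the member `P'` in which `R` was stopped. If `P' ⊂ P`, recurse on `P'`. If `P ⊂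
P'`, recursion puts `P` in a stopped set of `P'`, which contradicts the maximality of `R`. The roles
may swap, hence induction on `i + j`. -/
theorem exists_stopped_of_ssubset (ht : IsMartingaleTree μ 𝒬) (hQ₀ : Q₀ ∈ tree 𝒬)
    (hR : R ∈ stopFamily 𝒬 a V Q₀ i) (hP : P ∈ stopFamily 𝒬 a V Q₀ j) (h : R ⊂ P) :
    ∃ Q ∈ stopped 𝒬 a V P, R ⊆ Q := by
  induction hN : i + j using Nat.strong_induction_on generalizing i j R P with
  | _ N ih =>
    cases i with
    | zero =>
      obtain rfl : R = Q₀ := hR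
      exact (h.not_subset (stopFamily_subset hQ₀ hP).2).elim
    | succ i =>
      obtain ⟨P', hP', hRs⟩ := hR
      obtain ⟨x, hx⟩ := ht.nonempty_of_mem_tree hRs.1.1
      have hss := hRs.1.2.1
      by_cases he : P' = P
      · exact ⟨R, he ▸ hRs, subset_rfl⟩
      rcases ht.subset_or_subset (stopFamily_subset hQ₀ hP').1 (stopFamily_subset hQ₀ hP).1
        (hss.subset hx) (h.subset hx) with h' | h'
      · obtain ⟨Q, hQ, hQ'⟩ := ih (i + j) (by omega) hP' hP (h'.ssubset_of_ne he) rfl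
        exact ⟨Q, hQ, hss.subset.trans hQ'⟩
      · obtain ⟨Q, hQ, hQ'⟩ := ih (j + i) (by omega) hP hP' (h'.ssubset_of_ne (Ne.symm he)) rfl
        have hQR : Q ⊆ R := hRs.2 hQ.1 (h.subset.trans hQ')
        exact (h.not_subset (hQ'.trans hQR)).elim

theorem sparseChildren_subset_stopped (ht : IsMartingaleTree μ 𝒬) (hQ₀ : Q₀ ∈ tree 𝒬)
    (hP : P ∈ stopFamily 𝒬 a V Q₀ j) :
    sparseChildren (⋃ j, stopFamily 𝒬 a V Q₀ j) P ⊆ stopped 𝒬 a V P := by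
  intro Q hQ
  obtain ⟨i, hi⟩ := Set.mem_iUnion.1 hQ.1.1
  obtain ⟨R, hR, hQR⟩ := exists_stopped_of_ssubset ht hQ₀ hi hP hQ.1.2
  have hRS : R ∈ ⋃ j, stopFamily 𝒬 a V Q₀ j := Set.mem_iUnion.2 ⟨j + 1, P, hP, hR⟩
  rwa [hQR.antisymm (hQ.2 ⟨hRS, hR.1.2.1⟩ hQR)]

theorem tsum_measure_eq_measure_sUnion [SigmaFinite μ] (ht : IsMartingaleTree μ 𝒬)
    {𝒯 : Set (Set Ω)} (h𝒯 : 𝒯 ⊆ tree 𝒬) (hd : 𝒯.PairwiseDisjoint id) :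
    ∑' Q : 𝒯, μ (Q : Set Ω) = μ (⋃₀ 𝒯) :=
  (measure_sUnion (ht.countable_tree.mono h𝒯) hd
    fun _ hQ => ht.measurableSet_of_mem_tree (h𝒯 hQ)).symm

theorem isSparse_stopFamily [SigmaFinite μ] (ht : IsMartingaleTree μ 𝒬)
    (hf : Integrable f μ) (hV : IsCarlesonTransform μ 𝒬 n₀ f w V) (hQ₀ : Q₀ ∈ 𝒬 n₀) :
    IsSparse μ 𝒬 (⋃ j, stopFamily 𝒬 (avgNorm μ f) V Q₀ j) := by
  have hQt : Q₀ ∈ tree 𝒬 := Set.mem_iUnion.2 ⟨n₀, hQ₀⟩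
  refine ⟨Set.iUnion_subset fun j P hP => (stopFamily_subset hQt hP).1, fun P hP => ?_⟩
  obtain ⟨j, hj⟩ := Set.mem_iUnion.1 hP
  obtain ⟨p, hp, hPp⟩ := ht.exists_ge_of_subset hQ₀ (stopFamily_subset hQt hj).1
    (stopFamily_subset hQt hj).2
  calc _ ≤ ∑' Q : stopped 𝒬 (avgNorm μ f) V P, μ (Q : Set Ω) :=
        ENNReal.tsum_mono_subtype (fun Q => μ Q) (sparseChildren_subset_stopped ht hQt hj)
    _ = μ (⋃₀ stopped 𝒬 (avgNorm μ f) V P) :=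
        tsum_measure_eq_measure_sUnion ht (fun Q hQ => hQ.1.1)
          fun Q hQ R hR h => stopped_disjoint ht hQ hR h
    _ ≤ _ := measure_sUnion_stopped_le ht hf hV hp hPp

theorem measure_sUnion_stopFamily_le [SigmaFinite μ] (ht : IsMartingaleTree μ 𝒬)
    (hf : Integrable f μ) (hV : IsCarlesonTransform μ 𝒬 n₀ f w V) (hQ₀ : Q₀ ∈ 𝒬 n₀) (j : ℕ) :
    μ (⋃₀ stopFamily 𝒬 (avgNorm μ f) V Q₀ j) ≤ 2⁻¹ ^ j * μ Q₀ := by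
  have hQt : Q₀ ∈ tree 𝒬 := Set.mem_iUnion.2 ⟨n₀, hQ₀⟩
  induction j with
  | zero => simp [stopFamily]
  | succ j ih =>
    set 𝒯 := stopFamily 𝒬 (avgNorm μ f) V Q₀ j with h𝒯
    have hsub : ⋃₀ stopFamily 𝒬 (avgNorm μ f) V Q₀ (j + 1) ⊆
        ⋃ P ∈ 𝒯, ⋃₀ stopped 𝒬 (avgNorm μ f) V P := by
      rintro x ⟨Q, ⟨P, hP, hQ⟩, hx⟩
      exact Set.mem_iUnion₂.2 ⟨P, hP, Q, hQ, hx⟩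
    have h𝒯t : 𝒯 ⊆ tree 𝒬 := fun P hP => (stopFamily_subset hQt hP).1
    calc _ ≤ _ := measure_mono hsub
      _ ≤ ∑' P : 𝒯, μ (⋃₀ stopped 𝒬 (avgNorm μ f) V P) :=
        measure_biUnion_le _ (ht.countable_tree.mono h𝒯t) _
      _ ≤ ∑' P : 𝒯, 2⁻¹ * μ (P : Set Ω) := by
        refine ENNReal.tsum_le_tsum fun P => ?_
        obtain ⟨p, hp, hPp⟩ := ht.exists_ge_of_subset hQ₀ (h𝒯t P.2) (stopFamily_subset hQt P.2).2
        exact measure_sUnion_stopped_le ht hf hV hp hPp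
      _ = 2⁻¹ * μ (⋃₀ 𝒯) := by
        rw [ENNReal.tsum_mul_left, tsum_measure_eq_measure_sUnion ht h𝒯t
          fun Q hQ R hR h => stopFamily_disjoint ht hQ hR h]
      _ ≤ 2⁻¹ * (2⁻¹ ^ j * μ Q₀) := mul_le_mul_right ih _
      _ = _ := by rw [pow_succ]; ring

theorem ae_exists_notMem_stopFamily [SigmaFinite μ] (ht : IsMartingaleTree μ 𝒬)
    (hf : Integrable f μ) (hV : IsCarlesonTransform μ 𝒬 n₀ f w V) (hQ₀ : Q₀ ∈ 𝒬 n₀) :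
    ∀ᵐ x ∂μ, ∃ j, x ∉ ⋃₀ stopFamily 𝒬 (avgNorm μ f) V Q₀ j := by
  have h0 : μ (⋂ j, ⋃₀ stopFamily 𝒬 (avgNorm μ f) V Q₀ j) = 0 := by
    have h1 : Tendsto (fun j : ℕ => (2⁻¹ : ℝ≥0∞) ^ j * μ Q₀) atTop (𝓝 (0 * μ Q₀)) :=
      ENNReal.Tendsto.mul_const (ENNReal.tendsto_pow_atTop_nhds_zero_of_lt_one (by simp))
        (Or.inr (ht.measure_lt_top n₀ Q₀ hQ₀).ne)
    rw [zero_mul] at h1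
    exact le_antisymm (ge_of_tendsto' h1 fun j => (measure_mono (Set.iInter_subset _ j)).trans
      (measure_sUnion_stopFamily_le ht hf hV hQ₀ j)) zero_le
  filter_upwards [measure_eq_zero_iff_ae_notMem.1 h0] with x hx
  simpa using hx

open scoped Classical in
theorem enorm_sub_le_tsum_stopFamily (ht : IsMartingaleTree μ 𝒬)
    (hV : IsCarlesonTransform μ 𝒬 n₀ f w V) (hQ₀ : Q₀ ∈ 𝒬 n₀)
    (hP : P ∈ stopFamily 𝒬 (avgNorm μ f) V Q₀ j) :
    ‖V P - V Q₀‖ₑ ≤ 12 * ∑' R : (⋃ j, stopFamily 𝒬 (avgNorm μ f) V Q₀ j : Set (Set Ω)),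
      if P ⊂ R then avgNorm μ f R else 0 := by
  have hQt : Q₀ ∈ tree 𝒬 := Set.mem_iUnion.2 ⟨n₀, hQ₀⟩
  induction j generalizing P with
  | zero =>
    obtain rfl : P = Q₀ := hP
    simp
  | succ j ih =>
    obtain ⟨P', hP', hPs⟩ := hP
    have hP'S : P' ∈ ⋃ j, stopFamily 𝒬 (avgNorm μ f) V Q₀ j := Set.mem_iUnion.2 ⟨j, hP'⟩
    obtain ⟨p, hp, hPp⟩ := ht.exists_ge_of_subset hQ₀ (stopFamily_subset hQt hP').1
      (stopFamily_subset hQt hP').2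
    calc ‖V P - V Q₀‖ₑ = ‖(V P - V P') + (V P' - V Q₀)‖ₑ := by rw [sub_add_sub_cancel]
      _ ≤ _ := enorm_add_le _ _
      _ ≤ _ := add_le_add (enorm_sub_le_of_mem_stopped ht hV hp hPp hPs) (ih hP')
      -- The term of `P'` is merged into the sum over the strict supersets of `P'`; all of these,
      -- and `P'` itself, strictly contain `P`.
      _ = 12 * ∑' R : (⋃ j, stopFamily 𝒬 (avgNorm μ f) V Q₀ j : Set (Set Ω)),
          ((if R = ⟨P', hP'S⟩ then avgNorm μ f R else 0) +
            if P' ⊂ R then avgNorm μ f R else 0) := by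
        rw [ENNReal.tsum_add, tsum_ite_eq, mul_add]
      _ ≤ _ := by
        refine mul_le_mul_right (ENNReal.tsum_le_tsum fun R => ?_) _
        have hss := hPs.1.2.1
        by_cases h1 : R = ⟨P', hP'S⟩
        · subst h1
          simp [hss]
        · by_cases h2 : P' ⊂ (R : Set Ω)
          · simp [h1, h2, hss.trans h2]
          · simp [h1, h2]

theorem ae_exists_tendsto_enorm_le_sparseOp [SigmaFinite μ] (ht : IsMartingaleTree μ 𝒬)
    (hf : Integrable f μ) (hV : IsCarlesonTransform μ 𝒬 n₀ f w V) (hQ₀ : Q₀ ∈ 𝒬 n₀) :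
    ∀ᵐ x ∂μ, x ∈ Q₀ → ∃ c, Tendsto (fun n => V (cell 𝒬 n x)) atTop (𝓝 c) ∧
      ‖c - V Q₀‖ₑ ≤ 12 * sparseOp μ (⋃ j, stopFamily 𝒬 (avgNorm μ f) V Q₀ j)
        (fun y => ‖f y‖ₑ) x := by
  classical
  have hQt : Q₀ ∈ tree 𝒬 := Set.mem_iUnion.2 ⟨n₀, hQ₀⟩
  have hae : ∀ᵐ x ∂μ, ∀ P ∈ {P | P ∈ tree 𝒬 ∧ P ⊆ Q₀},
      x ∈ P → x ∉ ⋃₀ stopped 𝒬 (avgNorm μ f) V P →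
      ∃ c, Tendsto (fun n => V (cell 𝒬 n x)) atTop (𝓝 c) ∧
        ‖c - V P‖ₑ ≤ 12 * avgNorm μ f P := by
    refine (ae_ball_iff (ht.countable_tree.mono fun P hP => hP.1)).2 fun P hP => ?_
    obtain ⟨p, hp, hPp⟩ := ht.exists_ge_of_subset hQ₀ hP.1 hP.2
    exact ae_exists_tendsto_of_notMem ht hf hV hp hPp
  filter_upwards [hae, ae_exists_notMem_stopFamily ht hf hV hQ₀] with x h1 h2 hx
  -- The last generation of the family that covers `x`: its member `P` has no stopped set through
  -- `x`.
  obtain ⟨j, ⟨P, hP, hxP⟩, hj⟩ : ∃ j, x ∈ ⋃₀ stopFamily 𝒬 (avgNorm μ f) V Q₀ j ∧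
      x ∉ ⋃₀ stopFamily 𝒬 (avgNorm μ f) V Q₀ (j + 1) := by
    by_contra! hcon
    obtain ⟨j, hj⟩ := h2
    refine hj (Nat.rec ?_ hcon j)
    exact ⟨Q₀, rfl, hx⟩
  have hPS : P ∈ ⋃ j, stopFamily 𝒬 (avgNorm μ f) V Q₀ j := Set.mem_iUnion.2 ⟨j, hP⟩
  obtain ⟨c, hc, hcP⟩ := h1 P (stopFamily_subset hQt hP) hxP
    fun ⟨Q, hQ, hxQ⟩ => hj ⟨Q, ⟨P, hP, hQ⟩, hxQ⟩
  refine ⟨c, hc, ?_⟩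
  calc ‖c - V Q₀‖ₑ = ‖(c - V P) + (V P - V Q₀)‖ₑ := by rw [sub_add_sub_cancel]
    _ ≤ _ := enorm_add_le _ _
    _ ≤ _ := add_le_add hcP (enorm_sub_le_tsum_stopFamily ht hV hQ₀ hP)
    _ = 12 * ∑' R : (⋃ j, stopFamily 𝒬 (avgNorm μ f) V Q₀ j : Set (Set Ω)),
          ((if R = ⟨P, hPS⟩ then avgNorm μ f R else 0) +
            if P ⊂ R then avgNorm μ f R else 0) := by
        rw [ENNReal.tsum_add, tsum_ite_eq, mul_add]
    _ ≤ _ := by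
        refine mul_le_mul_right (ENNReal.tsum_le_tsum fun R => ?_) _
        rw [Set.indicator_apply]
        by_cases h1 : R = ⟨P, hPS⟩
        · subst h1
          simp [hxP, avgNorm]
        · by_cases h2 : P ⊂ (R : Set Ω)
          · simp [h1, h2, h2.subset hxP, avgNorm]
          · simp [h1, h2]

/-! ### The paraproduct sums as a Carleson transform -/

open scoped Classical in
/-- The value on `Q` of the partial sums of the paraproduct started at the generation `n₀`. -/
def chainSum (μ : Measure Ω) (𝒬 : ℤ → Set (Set Ω)) (b : Set Ω → Ω → 𝕜) (f : Ω → 𝕜) (n₀ : ℤ)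
    (Q : Set Ω) : 𝕜 :=
  if h : ∃ q : ℤ × Ω, n₀ ≤ q.1 ∧ cell 𝒬 q.1 q.2 = Q then
    ∑ k ∈ Finset.Ico n₀ h.choose.1, increment μ 𝒬 b f k h.choose.2 else 0

/-- The sum depends only on the set, not on the point or generation representing it, because
increments vanish while a cell repeats. Hence the choice in `chainSum` is harmless. -/
theorem sum_increment_congr [SigmaFinite μ] (ht : IsMartingaleTree μ 𝒬)
    (hb : IsParaproductSymbol μ 𝒬 b) (f : Ω → 𝕜) (hn : n₀ ≤ n) (hnm : n ≤ m)
    (h : cell 𝒬 n x = cell 𝒬 m y) :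
    ∑ k ∈ Finset.Ico n₀ n, increment μ 𝒬 b f k x =
      ∑ k ∈ Finset.Ico n₀ m, increment μ 𝒬 b f k y := by
  have hy : cell 𝒬 n y = cell 𝒬 n x := ht.cell_eq_cell (h ▸ ht.mem_cell m y)
  have h1 : ∑ k ∈ Finset.Ico n₀ n, increment μ 𝒬 b f k x =
      ∑ k ∈ Finset.Ico n₀ n, increment μ 𝒬 b f k y := by
    refine Finset.sum_congr rfl fun k hk => increment_congr ht b f ?_
    have := (Finset.mem_Ico.1 hk).2
    exact (ht.cell_congr (by omega) hy).symm
  have hmy : cell 𝒬 m y = cell 𝒬 n y := h.symm.trans hy.symm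
  rw [h1]
  clear h h1
  induction m, hnm using Int.leInduction with
  | base => rfl
  | succ m hm ih =>
    have h2 := ht.cell_eq_of_le_of_le hm (by omega : m ≤ m + 1) hmy
    rw [sum_Ico_add_one _ (hn.trans hm), increment_eq_zero ht hb f (hmy.trans h2.symm), add_zero,
      ih h2]

theorem chainSum_cell [SigmaFinite μ] (ht : IsMartingaleTree μ 𝒬)
    (hb : IsParaproductSymbol μ 𝒬 b) (f : Ω → 𝕜) (hn : n₀ ≤ n) (x : Ω) :
    chainSum μ 𝒬 b f n₀ (cell 𝒬 n x) = ∑ k ∈ Finset.Ico n₀ n, increment μ 𝒬 b f k x := by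
  have h : ∃ q : ℤ × Ω, n₀ ≤ q.1 ∧ cell 𝒬 q.1 q.2 = cell 𝒬 n x := ⟨(n, x), hn, rfl⟩
  rw [chainSum, dif_pos h]
  rcases le_total h.choose.1 n with h' | h'
  · exact sum_increment_congr ht hb f h.choose_spec.1 h' h.choose_spec.2
  · exact (sum_increment_congr ht hb f hn h' h.choose_spec.2.symm).symm

theorem chainSum_sub [SigmaFinite μ] (ht : IsMartingaleTree μ 𝒬)
    (hb : IsParaproductSymbol μ 𝒬 b) (f : Ω → 𝕜) (hn : n₀ ≤ n) (x : Ω) :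
    chainSum μ 𝒬 b f n₀ (cell 𝒬 (n + 1) x) - chainSum μ 𝒬 b f n₀ (cell 𝒬 n x) =
      increment μ 𝒬 b f n x := by
  rw [chainSum_cell ht hb f hn, chainSum_cell ht hb f (by omega), sum_Ico_add_one _ hn,
    add_sub_cancel_left]

theorem isCarlesonTransform_chainSum [SigmaFinite μ] (ht : IsMartingaleTree μ 𝒬)
    (hb : IsParaproductSymbol μ 𝒬 b) (f : Ω → 𝕜) (n₀ : ℤ) :
    IsCarlesonTransform μ 𝒬 n₀ f (fun Q => eLpNorm (b Q) ∞ μ) (chainSum μ 𝒬 b f n₀) where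
  le_one _ hQ := hb.eLpNorm_le_one ht hQ
  tsum_le _ hP := hb.tsum_le ht hP
  enorm_sub_le n hn x := by
    rw [chainSum_sub ht hb f hn, increment, enorm_mul]
    exact mul_le_mul' (enorm_setAverage_le _ _)
      (IsParaproductSymbol.enorm_setAverage_le_eLpNorm b _ _)
  setIntegral_eq n hn R hR := by
    have hRm := ht.measurableSet n R hR
    have hRt : R ∈ tree 𝒬 := Set.mem_iUnion.2 ⟨n, hR⟩
    simp only [chainSum_sub ht hb f hn]
    by_cases hc : R ∈ 𝒬 (n + 1)
    · refine setIntegral_eq_zero_of_forall_eq_zero fun x hx => increment_eq_zero ht hb f ?_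
      rw [ht.cell_eq hR hx, ht.cell_eq hc hx]
    · have h1 : ∫ x in R, increment μ 𝒬 b f n x ∂μ =
          ∫ x in R, (⨍ y in R, f y ∂μ) * b R x ∂μ := by
        refine setIntegral_congr_ae hRm ?_
        filter_upwards [hb.ae_isRegular ht] with x hx hxR
        have h2 := ht.cell_eq hR hxR
        rw [increment_eq ht hb f hx fun h => hc (by
          rw [← h2, ← h]; exact ht.cell_mem (n + 1) x), h2]
      rw [h1, integral_const_mul, hb.setIntegral_eq_zero ht hRt, mul_zero]

theorem sum_Ico_add_sum_Ico {M : Type*} [AddCommMonoid M] (g : ℤ → M) {m l n : ℤ} (h₁ : m ≤ l)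
    (h₂ : l ≤ n) :
    ∑ k ∈ Finset.Ico m l, g k + ∑ k ∈ Finset.Ico l n, g k = ∑ k ∈ Finset.Ico m n, g k := by
  induction n, h₂ using Int.leInduction with
  | base => simp
  | succ n hn ih => rw [sum_Ico_add_one _ hn, sum_Ico_add_one _ (h₁.trans hn), ← add_assoc, ih]

/-- Splitting at `n₀` leaves two independent one-sided limits and a boundary term, which vanishes
because convergence upwards forces the increments to zero. -/
theorem tendsto_paraproductPartial [SigmaFinite μ] (ht : IsMartingaleTree μ 𝒬)
    (hb : IsParaproductSymbol μ 𝒬 b) (hx : IsParaproductSymbol.IsRegular μ 𝒬 b x) {L c : 𝕜}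
    (hL : Tendsto (fun m => ∑ k ∈ Finset.Ico m n₀, increment μ 𝒬 b f k x) atBot (𝓝 L))
    (hc : Tendsto (fun n => ∑ k ∈ Finset.Ico n₀ n, increment μ 𝒬 b f k x) atTop (𝓝 c)) :
    Tendsto (fun p : ℤ × ℤ => paraproductPartial μ 𝒬 b f p.1 p.2 x) (atBot ×ˢ atTop)
      (𝓝 (L + c)) := by
  have h0 : Tendsto (fun n => increment μ 𝒬 b f n x) atTop (𝓝 0) := by
    have h1 := (hc.comp (tendsto_atTop_add_const_right _ (1 : ℤ) tendsto_id)).sub hc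
    rw [sub_self] at h1
    refine h1.congr' ?_
    filter_upwards [eventually_ge_atTop n₀] with n hn
    simp only [Function.comp_apply, id_eq]
    rw [sum_Ico_add_one _ hn, add_sub_cancel_left]
  have h2 := ((hL.comp tendsto_fst).add (hc.comp (tendsto_snd (f := (atBot : Filter ℤ))))).add
    ((tendsto_last_term ht hb hx h0).comp (tendsto_snd (f := (atBot : Filter ℤ))))
  rw [add_zero] at h2
  refine h2.congr' ?_
  filter_upwards [(eventually_le_atBot n₀).prod_mk (eventually_ge_atTop n₀)] with q hq
  rw [paraproductPartial_eq ht hb f hx (hq.1.trans hq.2), ← sum_Ico_add_sum_Ico _ hq.1 hq.2]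
  rfl

end MartingalePara

end

/-! ### The sparse domination theorem -/

theorem theorem2p3 :
    ∃ C : ℝ≥0, ∀ (𝕜 : Type*) [RCLike 𝕜] (Ω : Type*) [MeasurableSpace Ω] (μ : Measure Ω)
      [SigmaFinite μ] (𝒬 : ℤ → Set (Set Ω)) (b : Set Ω → Ω → 𝕜),
      MartingalePara.IsMartingaleTree μ 𝒬 →
      MartingalePara.IsParaproductSymbol μ 𝒬 b →
      ∀ Q₀ ∈ MartingalePara.tree 𝒬, ∀ f : Ω → 𝕜, Integrable f μ →
        (∀ᵐ x ∂μ, x ∉ Q₀ → f x = 0) →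
        (∀ᵐ x ∂μ, Tendsto
          (fun p : ℤ × ℤ => MartingalePara.paraproductPartial μ 𝒬 b f p.1 p.2 x)
          (atBot ×ˢ atTop) (𝓝 (MartingalePara.paraproduct μ 𝒬 b f x))) ∧
        ∃ 𝒮 : Set (Set Ω), MartingalePara.IsSparse μ 𝒬 𝒮 ∧
          ∀ᵐ x ∂μ, Q₀.indicator (fun y => ‖MartingalePara.paraproduct μ 𝒬 b f y‖ₑ) x ≤
            C * MartingalePara.sparseOp μ 𝒮 (fun y => ‖f y‖ₑ) x := by
  -- `13 = 12 + 1`: 12 from the stopping argument, 1 from the large sets, which are absorbed by the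
  -- term of `Q₀` in the sparse sum.
  refine ⟨13, fun 𝕜 _ Ω _ μ _ 𝒬 b ht hb Q₀ hQt f hf hsupp => ?_⟩
  obtain ⟨n₀, hQ₀⟩ := Set.mem_iUnion.1 hQt
  open MartingalePara in
  have hV := isCarlesonTransform_chainSum ht hb f n₀
  set V := chainSum μ 𝒬 b f n₀ with hVdef
  set 𝒮 := ⋃ j, stopFamily 𝒬 (avgNorm μ f) V Q₀ j with h𝒮
  have hQ₀S : Q₀ ∈ 𝒮 := Set.mem_iUnion.2 ⟨0, rfl⟩
  have hmain : ∀ᵐ x ∂μ, ∃ l : 𝕜, Tendsto (fun p : ℤ × ℤ => paraproductPartial μ 𝒬 b f p.1 p.2 x)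
      (atBot ×ˢ atTop) (𝓝 l) ∧
      (x ∈ Q₀ → ‖l‖ₑ ≤ 13 * sparseOp μ 𝒮 (fun y => ‖f y‖ₑ) x) := by
    filter_upwards [hb.ae_isRegular ht, ae_exists_tendsto_enorm_le_sparseOp ht hf hV hQ₀]
      with x hreg hx
    obtain ⟨L, hL, hLle⟩ := exists_tendsto_sum_atBot ht hb hf n₀ x
    by_cases hxQ : x ∈ Q₀
    · obtain ⟨c, hc, hcle⟩ := hx hxQ
      have hV0 : V Q₀ = 0 := by
        rw [← ht.cell_eq hQ₀ hxQ, hVdef, chainSum_cell ht hb f le_rfl]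
        simp
      rw [hV0, sub_zero] at hcle
      have hc' : Tendsto (fun n => ∑ k ∈ Finset.Ico n₀ n, increment μ 𝒬 b f k x) atTop (𝓝 c) := by
        refine hc.congr' ?_
        filter_upwards [eventually_ge_atTop n₀] with n hn
        exact chainSum_cell ht hb f hn x
      refine ⟨L + c, tendsto_paraproductPartial ht hb hreg hL hc', fun _ => ?_⟩
      -- The support condition turns the full `L¹` norm of `f` into its mass on `Q₀`, so the bound
      -- for the large sets is `⟨|f|⟩_{Q₀}`.
      have hint : ∫⁻ y, ‖f y‖ₑ ∂μ = ∫⁻ y in Q₀, ‖f y‖ₑ ∂μ := by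
        rw [← lintegral_indicator (ht.measurableSet n₀ Q₀ hQ₀)]
        refine lintegral_congr_ae ?_
        filter_upwards [hsupp] with y hy
        by_cases hyQ : y ∈ Q₀
        · rw [Set.indicator_of_mem hyQ]
        · rw [Set.indicator_of_notMem hyQ, hy hyQ, enorm_zero]
      rw [ht.cell_eq hQ₀ hxQ, hint, ← setLAverage_eq] at hLle
      have hone : ⨍⁻ y in Q₀, ‖f y‖ₑ ∂μ ≤ sparseOp μ 𝒮 (fun y => ‖f y‖ₑ) x := by
        refine le_trans (le_of_eq ?_) (ENNReal.le_tsum (⟨Q₀, hQ₀S⟩ : 𝒮))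
        rw [Set.indicator_of_mem hxQ]
      calc ‖L + c‖ₑ ≤ ‖L‖ₑ + ‖c‖ₑ := enorm_add_le _ _
        _ ≤ 1 * sparseOp μ 𝒮 (fun y => ‖f y‖ₑ) x + 12 * sparseOp μ 𝒮 (fun y => ‖f y‖ₑ) x :=
          add_le_add ((hLle.trans hone).trans_eq (one_mul _).symm) hcle
        _ = _ := by rw [← add_mul]; norm_num
    -- Outside `Q₀` the cells of generation at least `n₀` are disjoint from `Q₀`, so the averages of
    -- `f` there vanish and only the large sets contribute.
    · refine ⟨L + 0, tendsto_paraproductPartial ht hb hreg hL ?_, fun h => (hxQ h).elim⟩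
      refine tendsto_const_nhds.congr fun n => (Finset.sum_eq_zero fun k hk => ?_).symm
      have hk' := (Finset.mem_Ico.1 hk).1
      have havg : ⨍ y in cell 𝒬 k x, f y ∂μ = 0 := by
        refine ht.setAverage_eq_of_ae (ht.cell_mem_tree k x) ?_
        filter_upwards [hsupp] with y hy hyc
        refine hy fun hyQ => hxQ ?_
        exact ht.subset_of_mem (ht.cell_mem k x) hQ₀ hk' hyc hyQ (ht.mem_cell k x)
      rw [increment, havg, zero_mul]
  refine ⟨?_, 𝒮, isSparse_stopFamily ht hf hV hQ₀, ?_⟩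
  · filter_upwards [hmain] with x ⟨l, hl, _⟩
    rwa [paraproduct, hl.limUnder_eq]
  · filter_upwards [hmain] with x ⟨l, hl, hle⟩
    by_cases hxQ : x ∈ Q₀
    · rw [Set.indicator_of_mem hxQ, paraproduct, hl.limUnder_eq]
      exact hle hxQ
    · rw [Set.indicator_of_notMem hxQ]
      exact zero_le
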